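/- Let $H=-\frac{d^2}{dx^2}+x^2$ be the harmonic oscillator on $L^2(\mathbb R)$, i.e. the closure of this operator with domain the Schwartz space $\mathcal S(\mathbb R)$. For a bounded operator $T$ on a Hilbert space let $s_0(T)\ge s_1(T)\ge\cdots$ be its singular values, $s_k(T)=\inf\{\|T-F\| : \operatorname{rank}F\le k\}$, and let $\mathcal L^{(1,\infty)}$ be the ideal of compact operators $T$ with $\sup_{n\ge 0}\frac{1}{\log(n+2)}\sum_{k=0}^{n}s_k(T)<\infty$. Let $\omega$ be a positive linear functional on the bounded real sequences with $\omega(a)=\lim_n a_n$ whenever $a$ converges, and $\omega(a_0,a_0,a_1,a_1,\dots)=\omega(a_0,a_1,\dots)$ for all $a$. The Dixmier trace $\mathrm{Tr}_\omega$ is the linear functional on $\mathcal L^{(1,\infty)}$ determined by $\mathrm{Tr}_\omega(T)=\omega\Big(\Big(\frac{1}{\log(n+2)}\sum_{k=0}^{n}s_k(T)\Big)_{n\ge0}\Big)$ for positive $T$; explicitly $\mathrm{Tr}_\omega(T)=\mathrm{Tr}_\omega((\operatorname{Re}T)_+)-\mathrm{Tr}_\omega((\operatorname{Re}T)_-)+i\,\mathrm{Tr}_\omega((\operatorname{Im}T)_+)-i\,\mathrm{Tr}_\omega((\operatorname{Im}T)_-)$.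 Let $f:\mathbb R\to\mathbb C$ be bounded and uniformly continuous, acting on $L^2(\mathbb R)$ by multiplication, and suppose that $f$ has the asymptotic mean property: the limits $\mu_{\pm}=\lim_{x\to\pm\infty}\frac1x\int_0^x f(u)\,du$ exist. Put $\mu(f)=\frac12\mu_-+\frac12\mu_+$. Then $H$ has a bounded inverse $H^{-1}$ on $L^2(\mathbb R)$, the operator $fH^{-1}$ belongs to $\mathcal L^{(1,\infty)}$, and for every such $\omega$ $$\mathrm{Tr}_\omega(fH^{-1})=\frac{\mu(f)}{2}.$$ -/

import Mathlib

open MeasureTheory Filter Topology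
open scoped ENNReal BoundedContinuousFunction SchwartzMap ComplexStarModule

noncomputable section

namespace HarmonicDixmier

/-! ### Singular values and the Dixmier trace -/

section Dixmier

variable {E : Type*} [NormedAddCommGroup E] [InnerProductSpace ℂ E] [CompleteSpace E]

/-- The `k`-th singular value (`k = 0, 1, 2, …`) of a bounded operator on a Hilbert space: the
distance in operator norm to the operators of rank at most `k`. For a compact operator these are
the eigenvalues of `|T|` in decreasing order, repeated according to multiplicity. -/
def singularValue (T : E →L[ℂ] E) (k : ℕ) : ℝ :=
  sInf {r : ℝ | ∃ F : E →L[ℂ] E, (F : E →ₗ[ℂ] E).rank ≤ (k : Cardinal) ∧ r = ‖T - F‖}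

/-- The logarithmic means `(s₀(T) + ⋯ + sₙ(T)) / log (n + 2)`. -/
def logMean (T : E →L[ℂ] E) (n : ℕ) : ℝ :=
  (∑ k ∈ Finset.range (n + 1), singularValue T k) / Real.log (n + 2)

/-- The Dixmier ideal `𝓛^(1,∞)`: compact operators with bounded logarithmic means. -/
def MemDixmierIdeal (T : E →L[ℂ] E) : Prop :=
  IsCompactOperator T ∧ ∃ C : ℝ, ∀ n, |logMean T n| ≤ C

/-- The functionals `ω` used to define Dixmier traces: positive linear forms on the bounded real
sequences which extend the limit and satisfy
`ω(a₀, a₀, a₁, a₁, a₂, a₂, …) = ω(a₀, a₁, a₂, …)`. -/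
structure DixmierLimit where
  /-- the underlying linear form on bounded sequences -/
  toLinearMap : (ℕ →ᵇ ℝ) →ₗ[ℝ] ℝ
  nonneg : ∀ a : ℕ →ᵇ ℝ, (∀ n, 0 ≤ a n) → 0 ≤ toLinearMap a
  eq_lim : ∀ (a : ℕ →ᵇ ℝ) (l : ℝ), Tendsto a atTop (𝓝 l) → toLinearMap a = l
  dilation : ∀ a b : ℕ →ᵇ ℝ, (∀ n, b n = a (n / 2)) → toLinearMap b = toLinearMap a

open Classical in
/-- `ω` applied to the sequence of logarithmic means of `T`. For positive `T` in the Dixmier ideal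
this is the Dixmier trace of `T`; it has the value `0` if the means are unbounded. -/
def dixmierTracePos (ω : DixmierLimit) (T : E →L[ℂ] E) : ℝ :=
  if h : ∃ C : ℝ, ∀ n, |logMean T n| ≤ C then
    ω.toLinearMap (BoundedContinuousFunction.ofNormedAddCommGroupDiscrete (logMean T) h.choose
      (fun n => by simpa [Real.norm_eq_abs] using h.choose_spec n))
  else 0

/-- The Dixmier trace of a self-adjoint operator, from the Jordan decomposition `T = T⁺ - T⁻`. -/
def dixmierTraceSA (ω : DixmierLimit) (T : E →L[ℂ] E) : ℝ :=
  dixmierTracePos ω T⁺ - dixmierTracePos ω T⁻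

/-- The Dixmier trace `Tr_ω`, the complex linear extension from the positive operators of the
Dixmier ideal to the whole ideal, evaluated through `T = Re T + i Im T`. -/
def dixmierTrace (ω : DixmierLimit) (T : E →L[ℂ] E) : ℂ :=
  (dixmierTraceSA ω (ℜ T : E →L[ℂ] E) : ℂ) +
    Complex.I * (dixmierTraceSA ω (ℑ T : E →L[ℂ] E) : ℂ)

end Dixmier

/-! ### The harmonic oscillator -/

/-- The Hilbert space `L²(ℝ)` of complex functions. -/
abbrev L2 : Type := Lp ℂ 2 (volume : Measure ℝ)

/-- `-d²/dx² + x²` as an operator on the Schwartz space. -/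
def schwartzOscillator : 𝓢(ℝ, ℂ) →L[ℂ] 𝓢(ℝ, ℂ) :=
  -(SchwartzMap.derivCLM ℂ ℂ ∘L SchwartzMap.derivCLM ℂ ℂ) +
    SchwartzMap.smulLeftCLM ℂ (fun x : ℝ => ((x : ℂ) ^ 2))

theorem schwartzOscillator_apply (φ : 𝓢(ℝ, ℂ)) (x : ℝ) :
    schwartzOscillator φ x = -deriv (deriv φ) x + (x : ℂ) ^ 2 * φ x := by
  have h : (fun x : ℝ => ((x : ℂ) ^ 2)).HasTemperateGrowth := by fun_prop
  have h2 : ⇑(SchwartzMap.derivCLM ℂ ℂ φ) = deriv φ := by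
    ext y; simp
  simp [schwartzOscillator, SchwartzMap.smulLeftCLM_apply_apply h, h2]

/-- The inclusion of the Schwartz space in `L²(ℝ)`. -/
def schwartzToL2 : 𝓢(ℝ, ℂ) →ₗ[ℂ] L2 :=
  (SchwartzMap.toLpCLM ℂ ℂ 2 (volume : Measure ℝ)).toLinearMap

theorem schwartzToL2_injective : Function.Injective schwartzToL2 :=
  SchwartzMap.injective_toLp 2 (volume : Measure ℝ)

/-- The operator `-d²/dx² + x²` in `L²(ℝ)` with domain the Schwartz functions. -/
def oscillatorOnSchwartz : L2 →ₗ.[ℂ] L2 where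
  domain := LinearMap.range schwartzToL2
  toFun := schwartzToL2 ∘ₗ schwartzOscillator.toLinearMap ∘ₗ
    (LinearEquiv.ofInjective schwartzToL2 schwartzToL2_injective).symm.toLinearMap

/-- The harmonic oscillator `H`: the closure of `-d²/dx² + x²` on the Schwartz functions, which
is the self-adjoint extension of that operator. -/
def harmonicOscillator : L2 →ₗ.[ℂ] L2 :=
  oscillatorOnSchwartz.closure

/-- The bounded operator `R` is the inverse of the unbounded operator `A`: the graph of `A`
is the transposed graph of `R`, that is, `A` is a bijection of its domain onto the whole
space with inverse `R`. -/
def IsBoundedInverse (A : L2 →ₗ.[ℂ] L2) (R : L2 →L[ℂ] L2) : Prop :=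
  ∀ u v : L2, (u, v) ∈ A.graph ↔ R v = u

open Classical in
/-- The bounded inverse `H⁻¹` of the harmonic oscillator (it is unique; the value would be `0` if
there were none). -/
def oscillatorInv : L2 →L[ℂ] L2 :=
  if h : ∃ R : L2 →L[ℂ] L2, IsBoundedInverse harmonicOscillator R then h.choose else 0

/-! ### Multiplication operators and the asymptotic mean -/

theorem memLp_top (f : ℝ →ᵇ ℂ) : MemLp f ∞ (volume : Measure ℝ) :=
  memLp_top_of_bound f.continuous.aestronglyMeasurable ‖f‖
    (Eventually.of_forall f.norm_coe_le_norm)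

/-- The operator of multiplication by a bounded continuous function on `L²(ℝ)`. -/
def mulOp (f : ℝ →ᵇ ℂ) : L2 →L[ℂ] L2 :=
  (ContinuousLinearMap.mul ℂ ℂ).holderL volume ∞ 2 2 ((memLp_top f).toLp f)

theorem mulOp_apply_ae (f : ℝ →ᵇ ℂ) (g : L2) :
    mulOp f g =ᵐ[volume] fun x => f x * g x := by
  have h1 := (ContinuousLinearMap.mul ℂ ℂ).coeFn_holder (r := 2) ((memLp_top f).toLp f) g
  filter_upwards [h1, (memLp_top f).coeFn_toLp] with x hx hy
  rw [hy] at hx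
  exact hx

/-- `f` has the asymptotic mean property with asymptotic mean `m`: the limits `μ₊`, `μ₋` of
`(1/x) ∫₀ˣ f` as `x → ±∞` exist and `m` is their average. -/
def HasAsymptoticMean (f : ℝ → ℂ) (m : ℂ) : Prop :=
  ∃ μm μp : ℂ,
    Tendsto (fun x : ℝ => (1 / (x : ℂ)) * ∫ u in (0 : ℝ)..x, f u) atBot (𝓝 μm) ∧
    Tendsto (fun x : ℝ => (1 / (x : ℂ)) * ∫ u in (0 : ℝ)..x, f u) atTop (𝓝 μp) ∧
    m = (1 / 2) * μm + (1 / 2) * μp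

end HarmonicDixmier

end

open MeasureTheory Filter Topology
open scoped ENNReal BoundedContinuousFunction SchwartzMap ComplexStarModule

noncomputable section

set_option linter.unusedSectionVars false

namespace HarmonicDixmier

section SingularValues

variable {E : Type*} [NormedAddCommGroup E] [InnerProductSpace ℂ E] [CompleteSpace E]

/-! ### Elementary properties of singular values -/

/-! The Hermite functions form an orthonormal basis of eigenvectors of the oscillator with
eigenvalues `2k + 1`, so the inverse is the diagonal operator `D` with entries `1 / (2k + 1)`, and
the theorem concerns `A ∘L D` with `A` multiplication by `f`. Two facts carry it.

First, the Dixmier trace of `A ∘L D` can be read off the diagonal (`dixmierTrace_comp_diagonal`).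
Split `S = Re (A D)` as `S⁺ - S⁻`; both parts have `s_k = O(1/k)`. On a subspace `W` of dimension at
most `2n` containing the ranges of near-optimal rank-`n` approximants, the trace of each part agrees
with its sum of `n` singular values up to `O(1)`. Replacing `W` by the span of the first `n` basis
vectors changes the trace of `S` by `O(n)` dimensions times a form of size `O(1/n)`, again `O(1)`.
Division by `log n` removes these errors. Only the difference of the logarithmic means of `S⁺` and
`S⁻` has to converge; every `ω` then returns its limit. The imaginary part is treated as `Re (-i A
D)`.

Second, the diagonal entries `a_k = ∫ h_k² f` have logarithmic means governed by `m`. Mehler's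
formula on the diagonal (`mehlerSum_eq`) turns the Abel means of `a_k` into averages of `f` against
Gaussians that spread out as `r → 1`. Integration by parts rewrites these through `(1/x) ∫₀ˣ f`, so
they tend to `m`. Integrating the power series in `r` passes from Abel means to logarithmic means
(`tendsto_logMean_of_abel`), and `1 / (2k + 1)` is `1 / (2 (k + 1))` up to a summable error, whence
the factor `1/2`. -/

theorem singularValue_le (T F : E →L[ℂ] E) {k : ℕ}
    (hF : (F : E →ₗ[ℂ] E).rank ≤ (k : Cardinal)) : singularValue T k ≤ ‖T - F‖ :=
  csInf_le ⟨0, by rintro _ ⟨F, -, rfl⟩; exact norm_nonneg _⟩ ⟨F, hF, rfl⟩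

theorem singularValue_set_nonempty (T : E →L[ℂ] E) (k : ℕ) :
    {r : ℝ | ∃ F : E →L[ℂ] E, (F : E →ₗ[ℂ] E).rank ≤ (k : Cardinal) ∧ r = ‖T - F‖}.Nonempty :=
  ⟨‖T - 0‖, 0, by simp, rfl⟩

theorem le_singularValue (T : E →L[ℂ] E) {k : ℕ} {r : ℝ}
    (h : ∀ F : E →L[ℂ] E, (F : E →ₗ[ℂ] E).rank ≤ (k : Cardinal) → r ≤ ‖T - F‖) :
    r ≤ singularValue T k :=
  le_csInf (singularValue_set_nonempty T k) (by rintro _ ⟨F, hF, rfl⟩; exact h F hF)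

theorem singularValue_nonneg (T : E →L[ℂ] E) (k : ℕ) : 0 ≤ singularValue T k :=
  le_singularValue T fun _ _ => norm_nonneg _

theorem exists_norm_sub_lt (T : E →L[ℂ] E) (k : ℕ) {r : ℝ} (h : singularValue T k < r) :
    ∃ F : E →L[ℂ] E, (F : E →ₗ[ℂ] E).rank ≤ (k : Cardinal) ∧ ‖T - F‖ < r := by
  obtain ⟨_, ⟨F, hF, rfl⟩, h2⟩ := exists_lt_of_csInf_lt (singularValue_set_nonempty T k) h
  exact ⟨F, hF, h2⟩

theorem singularValue_le_add_norm_sub (T S : E →L[ℂ] E) (k : ℕ) :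
    singularValue T k ≤ singularValue S k + ‖T - S‖ := by
  rw [← sub_le_iff_le_add]
  refine le_singularValue S fun F hF => ?_
  have h1 := singularValue_le T F hF
  have h2 := norm_add_le (T - S) (S - F)
  rw [sub_add_sub_cancel] at h2
  linarith

theorem finiteDimensional_range_of_rank_le {F : E →L[ℂ] E} {k : ℕ}
    (hF : (F : E →ₗ[ℂ] E).rank ≤ (k : Cardinal)) :
    FiniteDimensional ℂ (LinearMap.range (F : E →ₗ[ℂ] E)) :=
  Module.rank_lt_aleph0_iff.1 (lt_of_le_of_lt hF (Cardinal.natCast_lt_aleph0))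

theorem finrank_range_le_of_rank_le {F : E →L[ℂ] E} {k : ℕ}
    (hF : (F : E →ₗ[ℂ] E).rank ≤ (k : Cardinal)) :
    Module.finrank ℂ (LinearMap.range (F : E →ₗ[ℂ] E)) ≤ k :=
  Module.finrank_le_of_rank_le hF

theorem rank_comp_starProjection_le (T : E →L[ℂ] E) (V : Submodule ℂ E) [FiniteDimensional ℂ V] :
    ((T ∘L V.starProjection : E →L[ℂ] E) : E →ₗ[ℂ] E).rank
      ≤ (Module.finrank ℂ V : Cardinal) := by
  have h1 : ((T ∘L V.starProjection : E →L[ℂ] E) : E →ₗ[ℂ] E)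
      = ((T : E →ₗ[ℂ] E) ∘ₗ V.subtype) ∘ₗ (V.orthogonalProjectionOnto : E →ₗ[ℂ] V) := by
    ext x; rfl
  rw [h1, Module.finrank_eq_rank]
  exact (LinearMap.rank_comp_le_left _ _).trans (LinearMap.rank_le_domain _)

/-- A bound for `T` on the orthogonal complement of a `k`-dimensional space bounds `s_k(T)`. -/
theorem singularValue_le_of_orthogonal (T : E →L[ℂ] E) (V : Submodule ℂ E)
    [FiniteDimensional ℂ V] {k : ℕ} (hV : Module.finrank ℂ V ≤ k) {r : ℝ} (hr : 0 ≤ r)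
    (h : ∀ x ∈ Vᗮ, ‖T x‖ ≤ r * ‖x‖) : singularValue T k ≤ r := by
  refine (singularValue_le T (T ∘L V.starProjection)
    ((rank_comp_starProjection_le T V).trans (by exact_mod_cast hV))).trans ?_
  refine ContinuousLinearMap.opNorm_le_bound _ hr fun x => ?_
  have h1 : (T - T ∘L V.starProjection) x = T (Vᗮ.starProjection x) := by
    simp [Submodule.starProjection_orthogonal]
  rw [h1]
  refine (h _ (Submodule.starProjection_apply_mem _ _)).trans ?_
  gcongr
  exact Submodule.norm_starProjection_apply_le _ _

/-- If `F` has rank at most `k`, its kernel has codimension at most `k`, and there `‖T x‖ ≤ ‖S x‖ =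
‖(S - F) x‖`. -/
theorem singularValue_le_of_norm_apply_le {T S : E →L[ℂ] E} (h : ∀ x, ‖T x‖ ≤ ‖S x‖) (k : ℕ) :
    singularValue T k ≤ singularValue S k := by
  refine le_singularValue S fun F hF => ?_
  have : FiniteDimensional ℂ (LinearMap.range (F : E →ₗ[ℂ] E)) :=
    finiteDimensional_range_of_rank_le hF
  set K : Submodule ℂ E := LinearMap.ker (F : E →ₗ[ℂ] E) with hK
  have hKc : IsClosed (K : Set E) := F.isClosed_ker
  have : CompleteSpace K := hKc.completeSpace_coe
  have hinj : Function.Injective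
      (((F : E →ₗ[ℂ] E).rangeRestrict) ∘ₗ Kᗮ.subtype) := by
    rw [← LinearMap.ker_eq_bot, LinearMap.ker_eq_bot']
    intro x hx
    have h1 : (x : E) ∈ K := by
      refine LinearMap.mem_ker.2 ?_
      simpa [Subtype.ext_iff] using hx
    have h2 := Submodule.inner_left_of_mem_orthogonal h1 x.2
    exact Subtype.ext (inner_self_eq_zero.1 h2)
  have : FiniteDimensional ℂ Kᗮ := Module.Finite.of_injective _ hinj
  refine singularValue_le_of_orthogonal T Kᗮ
    ((LinearMap.finrank_le_finrank_of_injective hinj).trans (finrank_range_le_of_rank_le hF))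
    (norm_nonneg _) fun x hx => ?_
  rw [Submodule.orthogonal_orthogonal] at hx
  have hx' : F x = 0 := hx
  refine (h x).trans ?_
  have := (S - F).le_opNorm x
  simpa [hx'] using this

theorem singularValue_comp_le (A D : E →L[ℂ] E) (k : ℕ) :
    singularValue (A ∘L D) k ≤ ‖A‖ * singularValue D k := by
  rcases (norm_nonneg A).eq_or_lt with h0 | h0
  · have hA : A = 0 := norm_eq_zero.1 h0.symm
    have := singularValue_le (A ∘L D) 0 (k := k) (by simp)
    simpa [hA] using this
  · rw [← div_le_iff₀' h0]
    refine le_singularValue D fun F hF => ?_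
    rw [div_le_iff₀' h0]
    have h1 := singularValue_le (A ∘L D) (A ∘L F) (k := k)
      ((LinearMap.rank_comp_le_right (F : E →ₗ[ℂ] E) (A : E →ₗ[ℂ] E)).trans hF)
    refine h1.trans ?_
    rw [← ContinuousLinearMap.comp_sub]
    exact ContinuousLinearMap.opNorm_comp_le _ _

/-! ### Traces over finite-dimensional subspaces -/

/-- The compression of an operator to a finite-dimensional subspace. -/
def compression (W : Submodule ℂ E) [FiniteDimensional ℂ W] (T : E →L[ℂ] E) : W →ₗ[ℂ] W :=
  (W.orthogonalProjectionOnto ∘L T ∘L W.subtypeL : W →L[ℂ] W)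

theorem inner_compression (W : Submodule ℂ E) [FiniteDimensional ℂ W] (T : E →L[ℂ] E) (x y : W) :
    inner ℂ x (compression W T y) = inner ℂ (x : E) (T y) := by
  simp [compression]

/-- The real part of the trace of the compression of an operator. -/
def traceOn (W : Submodule ℂ E) [FiniteDimensional ℂ W] (T : E →L[ℂ] E) : ℝ :=
  (LinearMap.trace ℂ W (compression W T)).re

theorem traceOn_sub (W : Submodule ℂ E) [FiniteDimensional ℂ W] (T S : E →L[ℂ] E) :
    traceOn W (T - S) = traceOn W T - traceOn W S := by
  have : compression W (T - S) = compression W T - compression W S := by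
    ext x; simp [compression]
  simp [traceOn, this]

theorem traceOn_eq_sum {ι : Type*} [Fintype ι] {W : Submodule ℂ E} [FiniteDimensional ℂ W]
    (T : E →L[ℂ] E) {e : ι → E} (he : Orthonormal ℂ e) (hW : Submodule.span ℂ (Set.range e) = W) :
    traceOn W T = ∑ i, (inner ℂ (e i) (T (e i))).re := by
  have hmem (i : ι) : e i ∈ W := hW ▸ Submodule.subset_span ⟨i, rfl⟩
  have hsp : ⊤ ≤ Submodule.span ℂ (Set.range (Set.codRestrict e W hmem)) := by
    rw [← Submodule.map_le_map_iff_of_injective W.injective_subtype, Submodule.map_span,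
      ← Set.range_comp]
    simp only [Submodule.map_top, Submodule.range_subtype]
    exact hW.ge
  let b := OrthonormalBasis.mk (he.codRestrict W hmem) hsp
  rw [traceOn, LinearMap.trace_eq_sum_inner _ b, Complex.re_sum]
  refine Finset.sum_congr rfl fun i _ => ?_
  rw [inner_compression]
  simp [b]

theorem exists_orthonormal_span_eq (W : Submodule ℂ E) [FiniteDimensional ℂ W] :
    ∃ e : Fin (Module.finrank ℂ W) → E, Orthonormal ℂ e ∧ Submodule.span ℂ (Set.range e) = W := by
  let b := stdOrthonormalBasis ℂ W
  refine ⟨fun i => (b i : E), b.orthonormal.comp_linearIsometry W.subtypeₗᵢ, ?_⟩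
  have h := congrArg (Submodule.map W.subtype) b.toBasis.span_eq
  rw [Submodule.map_span, ← Set.range_comp] at h
  simpa [Function.comp_def] using h

theorem abs_traceOn_le (W : Submodule ℂ E) [FiniteDimensional ℂ W] (T : E →L[ℂ] E) {c : ℝ}
    (h : ∀ v ∈ W, |(inner ℂ v (T v)).re| ≤ c * ‖v‖ ^ 2) :
    |traceOn W T| ≤ Module.finrank ℂ W * c := by
  obtain ⟨e, he, hW⟩ := exists_orthonormal_span_eq W
  rw [traceOn_eq_sum T he hW]
  refine (Finset.abs_sum_le_sum_abs _ _).trans ?_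
  refine (Finset.sum_le_card_nsmul _ _ c fun i _ => ?_).trans (by simp)
  have := h (e i) (hW ▸ Submodule.subset_span ⟨i, rfl⟩)
  simpa [he.1 i] using this

theorem traceOn_eq_add {U V W : Submodule ℂ E} [FiniteDimensional ℂ U] [FiniteDimensional ℂ V]
    [FiniteDimensional ℂ W] (hUV : U ⟂ V) (hW : U ⊔ V = W) (T : E →L[ℂ] E) :
    traceOn W T = traceOn U T + traceOn V T := by
  obtain ⟨e, he, hU⟩ := exists_orthonormal_span_eq U
  obtain ⟨e', he', hV⟩ := exists_orthonormal_span_eq V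
  have horth (i j) : inner ℂ (e i) (e' j) = 0 :=
    hUV.inner_eq (hU ▸ Submodule.subset_span ⟨i, rfl⟩) (hV ▸ Submodule.subset_span ⟨j, rfl⟩)
  have hs : Orthonormal ℂ (Sum.elim e e') := by
    refine ⟨by rintro (i | i) <;> simp [he.1, he'.1], ?_⟩
    rintro (i | i) (j | j) hij
    · exact he.2 fun h => hij (by rw [h])
    · exact horth i j
    · exact inner_eq_zero_symm.1 (horth j i)
    · exact he'.2 fun h => hij (by rw [h])
  rw [traceOn_eq_sum T he hU, traceOn_eq_sum T he' hV, traceOn_eq_sum T hs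
    (by rw [Set.Sum.elim_range, Submodule.span_union, hU, hV, hW]), Fintype.sum_sum_type]
  simp

/-- The two traces differ by the trace over `Uᗮ ⊓ W`, which has dimension at most `d`. This allows
one test subspace to be exchanged for another at bounded cost. -/
theorem abs_traceOn_sub_le {U W : Submodule ℂ E} [FiniteDimensional ℂ U] [FiniteDimensional ℂ W]
    (hUW : U ≤ W) (T : E →L[ℂ] E) {c : ℝ} (hc : 0 ≤ c) {d : ℕ}
    (hd : Module.finrank ℂ W ≤ Module.finrank ℂ U + d)
    (h : ∀ v ∈ Uᗮ, |(inner ℂ v (T v)).re| ≤ c * ‖v‖ ^ 2) :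
    |traceOn W T - traceOn U T| ≤ d * c := by
  have hfin : FiniteDimensional ℂ (Uᗮ ⊓ W : Submodule ℂ E) :=
    Submodule.finiteDimensional_of_le inf_le_right
  have hdim := Submodule.finrank_add_inf_finrank_orthogonal hUW
  rw [traceOn_eq_add (U := U) (V := Uᗮ ⊓ W) (W := W)
    ((Submodule.isOrtho_orthogonal_right U).mono_right inf_le_left)
    (Submodule.sup_orthogonal_inf_of_hasOrthogonalProjection hUW) T, add_sub_cancel_left]
  refine (abs_traceOn_le (Uᗮ ⊓ W) T fun v hv => h v hv.1).trans ?_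
  have : Module.finrank ℂ (Uᗮ ⊓ W : Submodule ℂ E) ≤ d := by omega
  gcongr

/-! ### Eigenvalues of compressions -/

theorem isSymmetric_compression (W : Submodule ℂ E) [FiniteDimensional ℂ W] {T : E →L[ℂ] E}
    (hT : T.IsPositive) : (compression W T).IsSymmetric := by
  intro x y
  rw [← inner_conj_symm, inner_compression, inner_compression, inner_conj_symm]
  exact hT.isSymmetric _ _

/-- The eigenvalues of the compression of a positive operator in decreasing order. -/
def compressionEigenvalues (W : Submodule ℂ E) [FiniteDimensional ℂ W] {T : E →L[ℂ] E}
    (hT : T.IsPositive) : Fin (Module.finrank ℂ W) → ℝ :=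
  (isSymmetric_compression W hT).eigenvalues rfl

theorem sum_compressionEigenvalues (W : Submodule ℂ E) [FiniteDimensional ℂ W] {T : E →L[ℂ] E}
    (hT : T.IsPositive) : ∑ i, compressionEigenvalues W hT i = traceOn W T :=
  ((isSymmetric_compression W hT).re_trace_eq_sum_eigenvalues rfl).symm

theorem compressionEigenvalues_antitone (W : Submodule ℂ E) [FiniteDimensional ℂ W]
    {T : E →L[ℂ] E} (hT : T.IsPositive) : Antitone (compressionEigenvalues W hT) :=
  (isSymmetric_compression W hT).eigenvalues_antitone rfl

theorem compressionEigenvalues_nonneg (W : Submodule ℂ E) [FiniteDimensional ℂ W]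
    {T : E →L[ℂ] E} (hT : T.IsPositive) (i) : 0 ≤ compressionEigenvalues W hT i := by
  refine eigenvalue_nonneg_of_nonneg (𝕜 := ℂ)
    ((isSymmetric_compression W hT).hasEigenvalue_eigenvalues rfl i) fun x => ?_
  rw [inner_compression]
  exact hT.re_inner_nonneg_right x

/-- Min-max: the span of the first `i + 1` eigenvectors is too large for an `F` of rank at most `i`
to be injective on it. At a nonzero vector of its kernel the form of `T` is at least the `i`-th
eigenvalue and at most `‖T - F‖`, relative to `‖x‖ ^ 2`. -/
theorem compressionEigenvalues_le_singularValue (W : Submodule ℂ E) [FiniteDimensional ℂ W]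
    {T : E →L[ℂ] E} (hT : T.IsPositive) (i : Fin (Module.finrank ℂ W)) :
    compressionEigenvalues W hT i ≤ singularValue T i := by
  refine le_singularValue T fun F hF => ?_
  set b := (isSymmetric_compression W hT).eigenvectorBasis rfl with hb
  let V : Submodule ℂ W := Submodule.span ℂ (Set.range fun j : Finset.Iic i => b j)
  have hVdim : Module.finrank ℂ V = i + 1 := by
    rw [finrank_span_eq_card]
    · rw [Fintype.card_coe, Fin.card_Iic]
    · exact (b.orthonormal.linearIndependent).comp _ Subtype.val_injective
  obtain ⟨x, hx0, hFx⟩ : ∃ x : V, x ≠ 0 ∧ F ((x : W) : E) = 0 := by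
    by_contra! hcon
    have hinj : Function.Injective ((F : E →ₗ[ℂ] E) ∘ₗ (W.subtype ∘ₗ V.subtype)) := by
      rw [← LinearMap.ker_eq_bot, LinearMap.ker_eq_bot']
      intro x hx
      by_contra h0
      exact hcon x h0 (by simpa using hx)
    have h1 := rank_range_of_injective _ hinj
    have h2 := (LinearMap.rank_comp_le_left (W.subtype ∘ₗ V.subtype) (F : E →ₗ[ℂ] E)).trans hF
    rw [LinearMap.rank, h1, ← Module.finrank_eq_rank, hVdim] at h2
    have : (i : ℕ) + 1 ≤ i := by exact_mod_cast h2
    omega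
  have hxj (j) (hj : i < j) : inner ℂ (b j) (x : W) = 0 := by
    have : V ≤ (ℂ ∙ b j)ᗮ := by
      rw [Submodule.span_le]
      rintro _ ⟨k, rfl⟩
      rw [SetLike.mem_coe, Submodule.mem_orthogonal_singleton_iff_inner_right]
      exact b.orthonormal.2 fun h => by
        have := Finset.mem_Iic.1 k.2
        rw [← h] at this
        exact absurd hj (not_lt.2 this)
    exact Submodule.mem_orthogonal_singleton_iff_inner_right.1 (this x.2)
  have hnorm : ∑ j, ‖inner ℂ (b j) (x : W)‖ ^ 2 = ‖(x : W)‖ ^ 2 := b.sum_sq_norm_inner_right _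
  have hval : (inner ℂ ((x : W) : E) (T (x : W))).re
      = ∑ j, compressionEigenvalues W hT j * ‖inner ℂ (b j) (x : W)‖ ^ 2 := by
    rw [← inner_compression, ← b.sum_inner_mul_inner, Complex.re_sum]
    refine Finset.sum_congr rfl fun j _ => ?_
    rw [← b.repr_apply_apply (compression W T x) j, hb,
      LinearMap.IsSymmetric.eigenvectorBasis_apply_self_apply, ← hb, b.repr_apply_apply,
      mul_left_comm, ← inner_conj_symm (x : W) (b j), RCLike.conj_mul]
    simp only [Complex.coe_algebraMap, ← Complex.ofReal_pow, ← Complex.ofReal_mul,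
      Complex.ofReal_re, compressionEigenvalues]
  have hlow : compressionEigenvalues W hT i * ‖(x : W)‖ ^ 2
      ≤ (inner ℂ ((x : W) : E) (T (x : W))).re := by
    rw [hval, ← hnorm, Finset.mul_sum]
    refine Finset.sum_le_sum fun j _ => ?_
    rcases lt_or_ge i j with h | h
    · simp [hxj j h]
    · gcongr
      exact compressionEigenvalues_antitone W hT h
  have hup : (inner ℂ ((x : W) : E) (T (x : W))).re ≤ ‖T - F‖ * ‖(x : W)‖ ^ 2 := by
    have h1 : T (x : W) = (T - F) (x : W) := by simp [hFx]
    rw [h1]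
    refine (Complex.re_le_norm _).trans ((norm_inner_le_norm _ _).trans ?_)
    have := (T - F).le_opNorm ((x : W) : E)
    calc ‖((x : W) : E)‖ * ‖(T - F) (x : W)‖ ≤ ‖((x : W) : E)‖ * (‖T - F‖ * ‖((x : W) : E)‖) := by
          gcongr
      _ = ‖T - F‖ * ‖(x : W)‖ ^ 2 := by rw [Submodule.norm_coe]; ring
  have hpos : 0 < ‖(x : W)‖ ^ 2 := by
    have : (x : W) ≠ 0 := by simpa using hx0
    positivity
  exact le_of_mul_le_mul_right (hlow.trans hup) hpos

/-- On the orthogonal complement of the first `i` eigenvectors the compressed operator only sees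
eigenvalues not exceeding the `i`-th one. -/
theorem singularValue_compress_le (W : Submodule ℂ E) [FiniteDimensional ℂ W]
    {T : E →L[ℂ] E} (hT : T.IsPositive) (i : Fin (Module.finrank ℂ W)) :
    singularValue (W.starProjection ∘L T ∘L W.starProjection) i
      ≤ compressionEigenvalues W hT i := by
  set b := (isSymmetric_compression W hT).eigenvectorBasis rfl with hb
  let V : Submodule ℂ E := Submodule.span ℂ (Set.range fun j : Finset.Iio i => (b j : E))
  have hVdim : Module.finrank ℂ V ≤ i := by
    refine (finrank_range_le_card _).trans ?_
    rw [Fintype.card_coe, Fin.card_Iio]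
  have : FiniteDimensional ℂ V := FiniteDimensional.span_of_finite ℂ (Set.finite_range _)
  refine singularValue_le_of_orthogonal _ V hVdim (compressionEigenvalues_nonneg W hT i)
    fun x hx => ?_
  set u : W := W.orthogonalProjectionOnto x with hu
  have hTx : (W.starProjection ∘L T ∘L W.starProjection) x = (compression W T u : W) := rfl
  rw [hTx, Submodule.norm_coe]
  have hle : ‖u‖ ≤ ‖x‖ := W.norm_orthogonalProjectionOnto_apply_le x
  have hue (j) (hj : j < i) : inner ℂ (b j) u = 0 := by
    have h1 : inner ℂ (b j : E) x = 0 :=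
      hx _ (Submodule.subset_span ⟨⟨j, Finset.mem_Iio.2 hj⟩, rfl⟩)
    rw [hu]
    simpa using h1
  have h2 : ‖compression W T u‖ ^ 2 ≤ (compressionEigenvalues W hT i * ‖u‖) ^ 2 := by
    rw [mul_pow, ← b.sum_sq_norm_inner_right, ← b.sum_sq_norm_inner_right u, Finset.mul_sum]
    refine Finset.sum_le_sum fun j _ => ?_
    rw [← b.repr_apply_apply (compression W T u) j, hb,
      LinearMap.IsSymmetric.eigenvectorBasis_apply_self_apply, ← hb, b.repr_apply_apply]
    rcases lt_or_ge j i with h | h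
    · simp [hue j h]
    · rw [norm_mul, mul_pow, RCLike.norm_ofReal, sq_abs]
      gcongr
      · exact compressionEigenvalues_nonneg W hT j
      · exact compressionEigenvalues_antitone W hT h
  have h3 := abs_le_of_sq_le_sq h2 (mul_nonneg (compressionEigenvalues_nonneg W hT i)
    (norm_nonneg _))
  rw [abs_of_nonneg (norm_nonneg _)] at h3
  refine h3.trans ?_
  gcongr
  exact compressionEigenvalues_nonneg W hT i

/-- The easy half of Ky Fan's principle, by summing the eigenvalue bounds. -/
theorem traceOn_le_sum_singularValue (W : Submodule ℂ E) [FiniteDimensional ℂ W]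
    {T : E →L[ℂ] E} (hT : T.IsPositive) {n : ℕ} (hn : Module.finrank ℂ W ≤ n) :
    traceOn W T ≤ ∑ k ∈ Finset.range n, singularValue T k := by
  calc traceOn W T ≤ ∑ i : Fin (Module.finrank ℂ W), singularValue T i := by
        rw [← sum_compressionEigenvalues W hT]
        exact Finset.sum_le_sum fun i _ => compressionEigenvalues_le_singularValue W hT i
    _ = ∑ k ∈ Finset.range (Module.finrank ℂ W), singularValue T k :=
        Fin.sum_univ_eq_sum_range (singularValue T) _
    _ ≤ _ := Finset.sum_le_sum_of_subset_of_nonneg (Finset.range_mono hn)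
        fun k _ _ => singularValue_nonneg T k

/-- Replacing `T` by its compression moves each singular value by at most the norm of the
difference, and the compression has at most `finrank W` nonzero singular values, bounded by
eigenvalues with sum `traceOn W T`. -/
theorem sum_singularValue_le_traceOn (W : Submodule ℂ E) [FiniteDimensional ℂ W]
    {T : E →L[ℂ] E} (hT : T.IsPositive) (n : ℕ) :
    ∑ k ∈ Finset.range n, singularValue T k
      ≤ traceOn W T + n * ‖T - W.starProjection ∘L T ∘L W.starProjection‖ := by
  set K := W.starProjection ∘L T ∘L W.starProjection with hK
  have hzero (k : ℕ) (hk : Module.finrank ℂ W ≤ k) : singularValue K k = 0 := by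
    refine le_antisymm ?_ (singularValue_nonneg _ _)
    refine singularValue_le_of_orthogonal K W hk le_rfl fun x hx => ?_
    simp [hK, (Submodule.starProjection_apply_eq_zero_iff W).2 hx]
  have h1 : ∑ k ∈ Finset.range n, singularValue K k ≤ traceOn W T := by
    calc ∑ k ∈ Finset.range n, singularValue K k
        -- Passing to the maximum covers both orders of `n` and the dimension of `W`; the terms
        -- beyond the dimension vanish.
        ≤ ∑ k ∈ Finset.range (max n (Module.finrank ℂ W)), singularValue K k :=
          Finset.sum_le_sum_of_subset_of_nonneg (Finset.range_mono (le_max_left _ _))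
            fun k _ _ => singularValue_nonneg K k
      _ = ∑ k ∈ Finset.range (Module.finrank ℂ W), singularValue K k := by
          symm
          refine Finset.sum_subset (Finset.range_mono (le_max_right _ _)) fun k _ hk => ?_
          exact hzero k (by simpa using hk)
      _ = ∑ i : Fin (Module.finrank ℂ W), singularValue K i :=
          (Fin.sum_univ_eq_sum_range (singularValue K) _).symm
      _ ≤ _ := by
          rw [← sum_compressionEigenvalues W hT]
          exact Finset.sum_le_sum fun i _ => singularValue_compress_le W hT i
  calc ∑ k ∈ Finset.range n, singularValue T k
      ≤ ∑ k ∈ Finset.range n, (singularValue K k + ‖T - K‖) :=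
        Finset.sum_le_sum fun k _ => singularValue_le_add_norm_sub T K k
    _ ≤ _ := by
        rw [Finset.sum_add_distrib]
        simp only [Finset.sum_const, Finset.card_range, nsmul_eq_mul]
        gcongr

end SingularValues

section Comparison

variable {E : Type*} [NormedAddCommGroup E] [InnerProductSpace ℂ E] [CompleteSpace E]

/-! ### Sums of singular values against traces -/

/-- Since `P F = F`, one has `T - P T = (1 - P)(T - F)`. The other piece `T - T P` is its adjoint,
so each contributes one `‖T - F‖`. -/
theorem norm_sub_compress_le {T F : E →L[ℂ] E} (hT : IsSelfAdjoint T) (W : Submodule ℂ E)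
    [FiniteDimensional ℂ W] (hF : ∀ x, F x ∈ W) :
    ‖T - W.starProjection ∘L T ∘L W.starProjection‖ ≤ 2 * ‖T - F‖ := by
  set P := W.starProjection
  have hPF : P ∘L F = F := by
    ext x; simpa [P] using W.starProjection_eq_self_iff.2 (hF x)
  have hQ : ‖Wᗮ.starProjection‖ ≤ 1 := Submodule.starProjection_norm_le _
  have h1 : T - P ∘L T = Wᗮ.starProjection ∘L (T - F) := by
    rw [Submodule.starProjection_orthogonal']
    ext x
    have := congrArg (fun G : E →L[ℂ] E => G x) hPF
    simp only [ContinuousLinearMap.comp_apply] at this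
    simp [P, sub_eq_add_neg, P] at this ⊢
    rw [this]; abel
  have h2 : ‖T - P ∘L T‖ ≤ ‖T - F‖ := by
    rw [h1]
    refine (ContinuousLinearMap.opNorm_comp_le _ _).trans ?_
    exact mul_le_of_le_one_left (norm_nonneg _) hQ
  have h3 : ‖T - T ∘L P‖ ≤ ‖T - F‖ := by
    have : T - T ∘L P = star (T - P ∘L T) := by
      have hP : star P = P := (isSelfAdjoint_starProjection W).star_eq
      change T - T * P = star (T - P * T)
      rw [star_sub, star_mul, hT.star_eq, hP]
    rw [this, norm_star]
    exact h2
  have h4 : T - P ∘L T ∘L P = (T - P ∘L T) + P ∘L (T - T ∘L P) := by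
    ext x; simp
  rw [h4]
  refine (norm_add_le _ _).trans ?_
  have h5 : ‖P ∘L (T - T ∘L P)‖ ≤ ‖T - F‖ := by
    refine (ContinuousLinearMap.opNorm_comp_le _ _).trans ?_
    exact (mul_le_of_le_one_left (norm_nonneg _) (Submodule.starProjection_norm_le _)).trans h3
  linarith

theorem abs_re_inner_le_of_mem_orthogonal {T F : E →L[ℂ] E} (W : Submodule ℂ E)
    (hF : ∀ x, F x ∈ W) {v : E} (hv : v ∈ Wᗮ) :
    |(inner ℂ v (T v)).re| ≤ ‖T - F‖ * ‖v‖ ^ 2 := by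
  have h1 : inner ℂ v (T v) = inner ℂ v ((T - F) v) := by
    simp [Submodule.inner_left_of_mem_orthogonal (hF v) hv]
  rw [h1]
  refine (Complex.abs_re_le_norm _).trans ((norm_inner_le_norm _ _).trans ?_)
  calc ‖v‖ * ‖(T - F) v‖ ≤ ‖v‖ * (‖T - F‖ * ‖v‖) := by
        gcongr; exact (T - F).le_opNorm v
    _ = _ := by ring

/-- The dimension bound `2n` leaves room for the ranges of two approximants. The second block of `n`
singular values sums to at most `C`, and the compression error is `n` times `2 (C + 1) / n`. -/
theorem abs_sum_singularValue_sub_traceOn_le {T F : E →L[ℂ] E} (hT : T.IsPositive) {C : ℝ}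
    (hC : ∀ k : ℕ, singularValue T k ≤ C / (k + 1)) {n : ℕ} (hn : 0 < n) (W : Submodule ℂ E)
    [FiniteDimensional ℂ W] (hdim : Module.finrank ℂ W ≤ n + n) (hF : ∀ x, F x ∈ W)
    (hTF : ‖T - F‖ ≤ (C + 1) / n) :
    |∑ k ∈ Finset.range n, singularValue T k - traceOn W T| ≤ 2 * (C + 1) := by
  have hn' : (0 : ℝ) < n := by exact_mod_cast hn
  have hC0 : 0 ≤ C := by simpa using (singularValue_nonneg T 0).trans (hC 0)
  rw [abs_le]
  constructor
  · have h1 := traceOn_le_sum_singularValue W hT hdim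
    rw [Finset.sum_range_add] at h1
    have h2 : ∑ k ∈ Finset.range n, singularValue T (n + k) ≤ C := by
      calc ∑ k ∈ Finset.range n, singularValue T (n + k)
          ≤ ∑ k ∈ Finset.range n, C / n := by
            refine Finset.sum_le_sum fun k _ => (hC _).trans ?_
            gcongr
            push_cast
            have : (0 : ℝ) ≤ k := by positivity
            linarith
        _ = C := by
            simp only [Finset.sum_const, Finset.card_range, nsmul_eq_mul]
            field_simp
    linarith
  · have h1 := sum_singularValue_le_traceOn W hT n
    have h2 := norm_sub_compress_le hT.isSelfAdjoint W hF
    have h3 : n * ‖T - W.starProjection ∘L T ∘L W.starProjection‖ ≤ 2 * (C + 1) := by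
      calc n * ‖T - W.starProjection ∘L T ∘L W.starProjection‖
          ≤ n * (2 * ((C + 1) / n)) := by gcongr; linarith
        _ = 2 * (C + 1) := by field_simp
    linarith

/-- For a difference of positive operators with singular values `O(1/k)`, the sums of singular
values differ from the diagonal sums in an adapted orthonormal system by a bounded amount. -/
theorem abs_sum_singularValue_sub_diagonal_le {T₁ T₂ : E →L[ℂ] E} (h₁ : T₁.IsPositive)
    (h₂ : T₂.IsPositive) {C : ℝ} (hC₁ : ∀ k : ℕ, singularValue T₁ k ≤ C / (k + 1))
    (hC₂ : ∀ k : ℕ, singularValue T₂ k ≤ C / (k + 1)) {e : ℕ → E} (he : Orthonormal ℂ e)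
    {n : ℕ} (hn : 0 < n) (hdiag : ∀ v : E, (∀ k < n, inner ℂ (e k) v = 0) →
      |(inner ℂ v ((T₁ - T₂) v)).re| ≤ C / n * ‖v‖ ^ 2) :
    |(∑ k ∈ Finset.range n, singularValue T₁ k - ∑ k ∈ Finset.range n, singularValue T₂ k)
      - ∑ k ∈ Finset.range n, (inner ℂ (e k) ((T₁ - T₂) (e k))).re| ≤ 8 * (C + 1) := by
  have hn' : (0 : ℝ) < n := by exact_mod_cast hn
  have hC0 : 0 ≤ C := by simpa using (singularValue_nonneg T₁ 0).trans (hC₁ 0)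
  have hlt (T : E →L[ℂ] E) (hC : ∀ k : ℕ, singularValue T k ≤ C / (k + 1)) :
      singularValue T n < (C + 1) / n := by
    refine (hC n).trans_lt ?_
    rw [div_lt_div_iff₀ (by positivity) hn']
    nlinarith
  obtain ⟨F₁, hF₁, hTF₁⟩ := exists_norm_sub_lt T₁ n (hlt T₁ hC₁)
  obtain ⟨F₂, hF₂, hTF₂⟩ := exists_norm_sub_lt T₂ n (hlt T₂ hC₂)
  have := finiteDimensional_range_of_rank_le hF₁
  have := finiteDimensional_range_of_rank_le hF₂
  set R₁ : Submodule ℂ E := LinearMap.range (F₁ : E →ₗ[ℂ] E)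
  set R₂ : Submodule ℂ E := LinearMap.range (F₂ : E →ₗ[ℂ] E)
  set W : Submodule ℂ E := R₁ ⊔ R₂
  have hWdim : Module.finrank ℂ W ≤ n + n :=
    (Submodule.finrank_add_le_finrank_add_finrank R₁ R₂).trans
      (add_le_add (finrank_range_le_of_rank_le hF₁) (finrank_range_le_of_rank_le hF₂))
  have hW₁ (x : E) : F₁ x ∈ W := Submodule.mem_sup_left ⟨x, rfl⟩
  have hW₂ (x : E) : F₂ x ∈ W := Submodule.mem_sup_right ⟨x, rfl⟩
  have ha := abs_sum_singularValue_sub_traceOn_le h₁ hC₁ hn W hWdim hW₁ hTF₁.le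
  have hb := abs_sum_singularValue_sub_traceOn_le h₂ hC₂ hn W hWdim hW₂ hTF₂.le
  set e' : Fin n → E := fun k => e k
  have he' : Orthonormal ℂ e' := he.comp _ Fin.val_injective
  set V : Submodule ℂ E := Submodule.span ℂ (Set.range e') with hV
  have : FiniteDimensional ℂ V := FiniteDimensional.span_of_finite ℂ (Set.finite_range _)
  have hVdim : Module.finrank ℂ V = n := by
    rw [finrank_span_eq_card he'.linearIndependent, Fintype.card_fin]
  have htr : traceOn V (T₁ - T₂)
      = ∑ k ∈ Finset.range n, (inner ℂ (e k) ((T₁ - T₂) (e k))).re := by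
    rw [traceOn_eq_sum (T₁ - T₂) he' hV.symm,
      ← Fin.sum_univ_eq_sum_range (fun k => (inner ℂ (e k) ((T₁ - T₂) (e k))).re)]
  have hsup : Module.finrank ℂ (W ⊔ V : Submodule ℂ E)
      ≤ Module.finrank ℂ W + Module.finrank ℂ V :=
    Submodule.finrank_add_le_finrank_add_finrank W V
  have hc : |traceOn (W ⊔ V) (T₁ - T₂) - traceOn W (T₁ - T₂)|
      -- Adjoining `V` to `W` adds at most `n` dimensions, all orthogonal to the ranges of both
      -- approximants, so each operator has form at most `(C + 1) / n` there.
      ≤ n * (2 * ((C + 1) / n)) := by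
    refine abs_traceOn_sub_le le_sup_left _ (by positivity) (hVdim ▸ hsup) fun v hv => ?_
    have g1 := abs_re_inner_le_of_mem_orthogonal (T := T₁) W hW₁ hv
    have g2 := abs_re_inner_le_of_mem_orthogonal (T := T₂) W hW₂ hv
    have g3 : ‖T₁ - F₁‖ * ‖v‖ ^ 2 ≤ (C + 1) / n * ‖v‖ ^ 2 := by gcongr
    have g4 : ‖T₂ - F₂‖ * ‖v‖ ^ 2 ≤ (C + 1) / n * ‖v‖ ^ 2 := by gcongr
    rw [sub_apply, inner_sub_right, Complex.sub_re]
    refine (abs_sub _ _).trans ?_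
    linarith
  -- Seen from `V`, at most `2n` dimensions are added, where `hdiag` applies. The total error is `2
  -- (C + 1)` for each of `T₁` and `T₂`, plus `2 (C + 1)` and `2 C`.
  have hd : |traceOn (W ⊔ V) (T₁ - T₂) - traceOn V (T₁ - T₂)|
      ≤ (n + n : ℕ) * (C / n) := by
    refine abs_traceOn_sub_le le_sup_right _ (by positivity) (by omega) fun v hv => ?_
    refine hdiag v fun k hk => ?_
    exact hv _ (Submodule.subset_span ⟨⟨k, hk⟩, rfl⟩)
  have hc' : (n : ℝ) * (2 * ((C + 1) / n)) = 2 * (C + 1) := by field_simp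
  have hd' : ((n + n : ℕ) : ℝ) * (C / n) = 2 * C := by push_cast; field_simp; ring
  rw [hc'] at hc
  rw [hd', htr] at hd
  have hs := traceOn_sub W T₁ T₂
  rw [abs_le] at *
  constructor <;> linarith [ha.1, ha.2, hb.1, hb.2, hc.1, hc.2, hd.1, hd.2]

/-! ### Logarithmic means and Dixmier traces of differences -/

theorem abs_logMean_le {T : E →L[ℂ] E} {C : ℝ}
    (hC : ∀ k : ℕ, singularValue T k ≤ C / (k + 1)) (n : ℕ) :
    |logMean T n| ≤ C * (1 / Real.log 2 + 1) := by
  have hC0 : 0 ≤ C := by simpa using (singularValue_nonneg T 0).trans (hC 0)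
  have hl2 : 0 < Real.log 2 := Real.log_pos (by norm_num)
  have hle : Real.log 2 ≤ Real.log (n + 2) :=
    Real.log_le_log (by norm_num) (by have : (0 : ℝ) ≤ n := by positivity
                                      linarith)
  have hl : 0 < Real.log (n + 2) := hl2.trans_le hle
  have hs0 : 0 ≤ ∑ k ∈ Finset.range (n + 1), singularValue T k :=
    Finset.sum_nonneg fun k _ => singularValue_nonneg T k
  rw [logMean, abs_of_nonneg (by positivity), div_le_iff₀ hl]
  calc ∑ k ∈ Finset.range (n + 1), singularValue T k
      ≤ ∑ k ∈ Finset.range (n + 1), C / (k + 1) := Finset.sum_le_sum fun k _ => hC k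
    _ = C * ((harmonic (n + 1) : ℚ) : ℝ) := by
        rw [harmonic, Rat.cast_sum, Finset.mul_sum]
        refine Finset.sum_congr rfl fun k _ => ?_
        push_cast
        rw [div_eq_mul_inv]
    _ ≤ C * (1 + Real.log ((n + 1 : ℕ) : ℝ)) := by
        gcongr; exact harmonic_le_one_add_log (n + 1)
    -- The additive `1` of the harmonic bound is absorbed by `log (n + 2) / log 2 ≥ 1`.
    _ ≤ C * (1 / Real.log 2 * Real.log (n + 2) + Real.log (n + 2)) := by
        gcongr
        · rw [one_div, inv_mul_eq_div, one_le_div hl2]; exact hle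
        · push_cast; linarith
    _ = _ := by ring

/-- By linearity of `ω` only the difference of the means has to converge; the two sequences need not
converge separately. -/
theorem dixmierTracePos_sub_eq (ω : DixmierLimit) {T₁ T₂ : E →L[ℂ] E}
    (h₁ : ∃ C : ℝ, ∀ n, |logMean T₁ n| ≤ C) (h₂ : ∃ C : ℝ, ∀ n, |logMean T₂ n| ≤ C) {l : ℝ}
    (h : Tendsto (fun n => logMean T₁ n - logMean T₂ n) atTop (𝓝 l)) :
    dixmierTracePos ω T₁ - dixmierTracePos ω T₂ = l := by
  rw [dixmierTracePos, dixmierTracePos, dif_pos h₁, dif_pos h₂, ← map_sub]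
  exact ω.eq_lim _ l h

theorem tendsto_log_natCast_add_two :
    Tendsto (fun n : ℕ => Real.log ((n : ℝ) + 2)) atTop atTop :=
  Real.tendsto_log_atTop.comp
    (tendsto_atTop_add_const_right _ _ tendsto_natCast_atTop_atTop)

/-- The Dixmier trace of a difference of positive operators from the diagonal sums. -/
theorem dixmierTracePos_sub_eq_of_diagonal (ω : DixmierLimit) {T₁ T₂ : E →L[ℂ] E}
    (h₁ : T₁.IsPositive) (h₂ : T₂.IsPositive) {C : ℝ}
    (hC₁ : ∀ k : ℕ, singularValue T₁ k ≤ C / (k + 1))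
    (hC₂ : ∀ k : ℕ, singularValue T₂ k ≤ C / (k + 1)) {e : ℕ → E} (he : Orthonormal ℂ e)
    (hdiag : ∀ n : ℕ, 0 < n → ∀ v : E, (∀ k < n, inner ℂ (e k) v = 0) →
      |(inner ℂ v ((T₁ - T₂) v)).re| ≤ C / n * ‖v‖ ^ 2) {l : ℝ}
    (hl : Tendsto (fun n : ℕ => (∑ k ∈ Finset.range (n + 1),
      (inner ℂ (e k) ((T₁ - T₂) (e k))).re) / Real.log (n + 2)) atTop (𝓝 l)) :
    dixmierTracePos ω T₁ - dixmierTracePos ω T₂ = l := by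
  refine dixmierTracePos_sub_eq ω ⟨_, abs_logMean_le hC₁⟩ ⟨_, abs_logMean_le hC₂⟩ ?_
  have h0 : Tendsto (fun n : ℕ => (logMean T₁ n - logMean T₂ n) -
      (∑ k ∈ Finset.range (n + 1), (inner ℂ (e k) ((T₁ - T₂) (e k))).re) / Real.log (n + 2))
      atTop (𝓝 0) := by
    refine squeeze_zero_norm (a := fun n : ℕ => 8 * (C + 1) / Real.log ((n : ℝ) + 2))
      (fun n => ?_) (tendsto_log_natCast_add_two.const_div_atTop _)
    have hl : 0 < Real.log ((n : ℝ) + 2) :=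
      Real.log_pos (by have : (0 : ℝ) ≤ n := by positivity
                       linarith)
    rw [logMean, logMean, ← sub_div, ← sub_div, Real.norm_eq_abs, abs_div, abs_of_pos hl]
    gcongr
    exact abs_sum_singularValue_sub_diagonal_le h₁ h₂ hC₁ hC₂ he n.succ_pos
      (hdiag _ n.succ_pos)
  simpa using h0.add hl

end Comparison

/-! ### Diagonal operators -/

section Diagonal

variable {E : Type*} [NormedAddCommGroup E] [InnerProductSpace ℂ E] [CompleteSpace E]

theorem _root_.HilbertBasis.hasSum_norm_inner_sq (b : HilbertBasis ℕ ℂ E) (x : E) :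
    HasSum (fun k => ‖inner ℂ (b k) x‖ ^ 2) (‖x‖ ^ 2) := by
  have h := Complex.hasSum_re (b.hasSum_inner_mul_inner x x)
  rw [inner_self_eq_norm_sq_to_K] at h
  convert h using 1
  · ext k
    rw [← inner_conj_symm x (b k), RCLike.conj_mul]
    norm_cast
  · norm_cast

theorem _root_.HilbertBasis.norm_le_of_norm_inner_le (b : HilbertBasis ℕ ℂ E) {x y : E} {r : ℝ}
    (hr : 0 ≤ r) (h : ∀ k, ‖inner ℂ (b k) x‖ ≤ r * ‖inner ℂ (b k) y‖) : ‖x‖ ≤ r * ‖y‖ := by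
  refine le_of_sq_le_sq ?_ (by positivity)
  rw [mul_pow]
  refine hasSum_le (fun k => ?_) (b.hasSum_norm_inner_sq x)
    ((b.hasSum_norm_inner_sq y).mul_left (r ^ 2))
  rw [← mul_pow]
  gcongr
  exact h k

theorem _root_.HilbertBasis.ext_inner (b : HilbertBasis ℕ ℂ E) {x y : E}
    (h : ∀ k, inner ℂ (b k) x = inner ℂ (b k) y) : x = y := by
  apply b.repr.injective
  ext k
  simp only [b.repr_apply_apply, h]

/-- A bounded sequence of numbers defines a diagonal operator in a Hilbert basis. -/
theorem exists_diagonal (b : HilbertBasis ℕ ℂ E) {c : ℕ → ℂ} (hc : ∀ k, ‖c k‖ ≤ 1) :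
    ∃ D : E →L[ℂ] E, ∀ k v, inner ℂ (b k) (D v) = c k * inner ℂ (b k) v := by
  have hmem (v : E) : Memℓp (fun k => c k * b.repr v k) 2 :=
    (lp.memℓp (b.repr v)).mono' fun k => by
      rw [norm_mul]; exact mul_le_of_le_one_left (norm_nonneg _) (hc k)
  let L : E →ₗ[ℂ] E :=
    { toFun := fun v => b.repr.symm ⟨fun k => c k * b.repr v k, hmem v⟩
      map_add' := fun v w => by
        rw [← map_add]; congr 1; ext k; simp only [map_add, lp.coeFn_add, Pi.add_apply, mul_add]
      map_smul' := fun a v => by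
        rw [RingHom.id_apply, ← map_smul]; congr 1; ext k; simp [mul_left_comm] }
  have hL (k v) : inner ℂ (b k) (L v) = c k * inner ℂ (b k) v := by
    rw [← b.repr_apply_apply, ← b.repr_apply_apply]
    simp [L]
  refine ⟨L.mkContinuous 1 fun v => b.norm_le_of_norm_inner_le zero_le_one fun k => ?_, hL⟩
  rw [hL, norm_mul]
  gcongr
  exact hc k

variable {b : HilbertBasis ℕ ℂ E} {D : E →L[ℂ] E}

/-- `D` is diagonal in the basis `b` with diagonal entries `1, 1/3, 1/5, …`. -/
def IsOddReciprocalDiagonal (b : HilbertBasis ℕ ℂ E) (D : E →L[ℂ] E) : Prop :=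
  ∀ k v, inner ℂ (b k) (D v) = (1 / (2 * k + 1) : ℂ) * inner ℂ (b k) v

theorem norm_two_mul_add_one_inv (k : ℕ) : ‖(1 / (2 * k + 1) : ℂ)‖ = 1 / (2 * (k : ℝ) + 1) := by
  have : (1 / (2 * k + 1) : ℂ) = ((1 / (2 * (k : ℝ) + 1) : ℝ) : ℂ) := by push_cast; rfl
  rw [this, Complex.norm_real, Real.norm_of_nonneg (by positivity)]

theorem diagonal_apply_basis (hD : IsOddReciprocalDiagonal b D)
    (k : ℕ) : D (b k) = (1 / (2 * k + 1) : ℂ) • b k := by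
  refine b.ext_inner fun j => ?_
  rw [hD, inner_smul_right]
  rcases eq_or_ne j k with rfl | h
  · rfl
  · simp [b.orthonormal.2 h]

theorem norm_diagonal_apply_le (hD : IsOddReciprocalDiagonal b D)
    {n : ℕ} {v : E} (hv : ∀ k < n, inner ℂ (b k) v = 0) :
    ‖D v‖ ≤ 1 / (2 * (n : ℝ) + 1) * ‖v‖ := by
  refine b.norm_le_of_norm_inner_le (by positivity) fun k => ?_
  rw [hD, norm_mul, norm_two_mul_add_one_inv]
  rcases lt_or_ge k n with h | h
  · simp [hv k h]
  · gcongr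

theorem norm_comp_diagonal_orthogonal_le (hD : IsOddReciprocalDiagonal b D)
    (n : ℕ) {V : Submodule ℂ E} [FiniteDimensional ℂ V]
    (hV : V = Submodule.span ℂ (Set.range fun k : Fin n => b k)) :
    ‖D - D ∘L V.starProjection‖ ≤ 1 / (2 * (n : ℝ) + 1) := by
  refine ContinuousLinearMap.opNorm_le_bound _ (by positivity) fun x => ?_
  have h1 : (D - D ∘L V.starProjection) x = D (Vᗮ.starProjection x) := by
    simp [Submodule.starProjection_orthogonal]
  rw [h1]
  refine (norm_diagonal_apply_le hD (n := n) fun k hk => ?_).trans ?_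
  · refine Submodule.starProjection_apply_mem Vᗮ x _ ?_
    rw [hV]
    exact Submodule.subset_span ⟨⟨k, hk⟩, rfl⟩
  · gcongr
    exact Submodule.norm_starProjection_apply_le _ _

theorem singularValue_diagonal_le (hD : IsOddReciprocalDiagonal b D)
    (k : ℕ) : singularValue D k ≤ 1 / (2 * (k : ℝ) + 1) := by
  let V : Submodule ℂ E := Submodule.span ℂ (Set.range fun j : Fin k => b j)
  have : FiniteDimensional ℂ V := FiniteDimensional.span_of_finite ℂ (Set.finite_range _)
  refine singularValue_le_of_orthogonal D V ((finrank_range_le_card _).trans (by simp))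
    (by positivity) fun x hx => norm_diagonal_apply_le hD fun j hj => ?_
  exact hx _ (Submodule.subset_span ⟨⟨j, hj⟩, rfl⟩)

theorem isCompactOperator_diagonal (hD : IsOddReciprocalDiagonal b D) : IsCompactOperator D := by
  let V (n : ℕ) : Submodule ℂ E := Submodule.span ℂ (Set.range fun j : Fin n => b j)
  have hV (n : ℕ) : FiniteDimensional ℂ (V n) :=
    FiniteDimensional.span_of_finite ℂ (Set.finite_range _)
  refine isCompactOperator_of_tendsto (l := atTop) (F := fun n => D ∘L (V n).starProjection)
    ?_ (Eventually.of_forall fun n => ?_)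
  · rw [tendsto_iff_norm_sub_tendsto_zero]
    refine squeeze_zero (fun _ => norm_nonneg _) (fun n => ?_)
      (tendsto_one_div_add_atTop_nhds_zero_nat (𝕜 := ℝ))
    rw [norm_sub_rev]
    refine (norm_comp_diagonal_orthogonal_le hD n rfl).trans ?_
    gcongr
    have : (0 : ℝ) ≤ n := by positivity
    linarith
  -- Each truncation factors through the finite-dimensional `V n`, whose identity is compact because
  -- closed balls are.
  · have hid : IsCompactOperator (id : V n → V n) := by
      have := FiniteDimensional.proper ℂ (V n)
      exact ⟨Metric.closedBall 0 1, isCompact_closedBall 0 1,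
        Metric.closedBall_mem_nhds _ zero_lt_one⟩
    have h2 := (hid.comp_clm (V n).orthogonalProjectionOnto).clm_comp (D ∘L (V n).subtypeL)
    exact h2

/-! ### Products of a bounded operator with the diagonal operator -/

theorem memDixmierIdeal_comp_diagonal (hD : IsOddReciprocalDiagonal b D)
    (A : E →L[ℂ] E) : MemDixmierIdeal (A ∘L D) := by
  refine ⟨(isCompactOperator_diagonal hD).clm_comp A, _,
    abs_logMean_le (C := ‖A‖) fun k => ?_⟩
  refine (singularValue_comp_le A D k).trans ?_
  rw [div_eq_mul_one_div]
  gcongr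
  refine (singularValue_diagonal_le hD k).trans ?_
  gcongr
  have : (0 : ℝ) ≤ k := by positivity
  linarith

/-- Truncating `D` to `j = ⌊k/2⌋` basis vectors gives `Y` of rank at most `j`; taking the real part
at most doubles the rank, which stays within `k`. The error `‖A‖ / (2j + 1)` is at most `2 ‖A‖ / (k
+ 1)` because `k ≤ 2j + 1`. -/
theorem singularValue_realPart_le (hD : IsOddReciprocalDiagonal b D) (A : E →L[ℂ] E) (k : ℕ) :
    singularValue (ℜ (A ∘L D) : E →L[ℂ] E) k ≤ 2 * ‖A‖ / (k + 1) := by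
  obtain ⟨j, hj1, hj2⟩ : ∃ j : ℕ, j + j ≤ k ∧ k ≤ j + j + 1 := ⟨k / 2, by omega, by omega⟩
  let V : Submodule ℂ E := Submodule.span ℂ (Set.range fun i : Fin j => b i)
  have : FiniteDimensional ℂ V := FiniteDimensional.span_of_finite ℂ (Set.finite_range _)
  have hVdim : Module.finrank ℂ V ≤ j := (finrank_range_le_card _).trans (by simp)
  set Y : E →L[ℂ] E := (A ∘L D) ∘L V.starProjection with hY
  have hY1 : (Y : E →ₗ[ℂ] E).rank ≤ (j : Cardinal) :=
    (rank_comp_starProjection_le _ V).trans (by exact_mod_cast hVdim)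
  have hstar : star Y = V.starProjection ∘L star (A ∘L D) := by
    change star ((A ∘L D) * V.starProjection) = V.starProjection * star (A ∘L D)
    rw [star_mul, (isSelfAdjoint_starProjection V).star_eq]
  have hY2 : ((star Y : E →L[ℂ] E) : E →ₗ[ℂ] E).rank ≤ (j : Cardinal) := by
    rw [hstar]
    refine (LinearMap.rank_comp_le_left ((star (A ∘L D) : E →L[ℂ] E) : E →ₗ[ℂ] E)
      (V.starProjection : E →ₗ[ℂ] E)).trans ?_
    exact (rank_comp_starProjection_le (ContinuousLinearMap.id ℂ E) V).trans
      (by exact_mod_cast hVdim)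
  have hrank : ((ℜ Y : E →L[ℂ] E) : E →ₗ[ℂ] E).rank ≤ (k : Cardinal) := by
    have h1 : ((ℜ Y : E →L[ℂ] E) : E →ₗ[ℂ] E)
        = ((2⁻¹ : ℂ) • LinearMap.id) ∘ₗ ((Y : E →ₗ[ℂ] E) + ((star Y : E →L[ℂ] E) : E →ₗ[ℂ] E)) := by
      ext x
      rw [realPart_apply_coe]
      simp only [ContinuousLinearMap.coe_coe, smul_apply, add_apply, LinearMap.comp_apply,
        LinearMap.id_apply, LinearMap.add_apply, LinearMap.smul_apply]
      rw [← Complex.coe_smul]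
      simp
    rw [h1]
    refine (LinearMap.rank_comp_le_right _ _).trans ((LinearMap.rank_add_le _ _).trans ?_)
    refine (add_le_add hY1 hY2).trans ?_
    exact_mod_cast hj1
  refine (singularValue_le _ _ hrank).trans ?_
  have h2 : ((ℜ (A ∘L D) : E →L[ℂ] E) - (ℜ Y : E →L[ℂ] E))
      = (ℜ (A ∘L (D - D ∘L V.starProjection)) : E →L[ℂ] E) := by
    rw [ContinuousLinearMap.comp_sub, map_sub]
    rfl
  rw [h2]
  have h3 : ‖(ℜ (A ∘L (D - D ∘L V.starProjection)) : E →L[ℂ] E)‖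
      ≤ ‖A ∘L (D - D ∘L V.starProjection)‖ :=
    realPart.norm_le (A ∘L (D - D ∘L V.starProjection))
  refine h3.trans ((ContinuousLinearMap.opNorm_comp_le _ _).trans ?_)
  calc ‖A‖ * ‖D - D ∘L V.starProjection‖ ≤ ‖A‖ * (1 / (2 * (j : ℝ) + 1)) := by
        gcongr; exact norm_comp_diagonal_orthogonal_le hD j rfl
    _ ≤ 2 * ‖A‖ / (k + 1) := by
        rw [mul_one_div, mul_comm, div_le_div_iff₀ (by positivity) (by positivity)]
        have : (k : ℝ) ≤ j + j + 1 := by exact_mod_cast hj2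
        have h0 := norm_nonneg A
        have hj0 : (0 : ℝ) ≤ j := by positivity
        nlinarith

/-- From `S⁺ S⁻ = 0` the vectors `S⁺ x` and `S⁻ x` are orthogonal. Hence both parts are dominated
pointwise by `S`, and so are their singular values. -/
theorem norm_posPart_apply_sq_add {S : E →L[ℂ] E} (hS : IsSelfAdjoint S) (x : E) :
    ‖S⁺ x‖ ^ 2 + ‖S⁻ x‖ ^ 2 = ‖S x‖ ^ 2 := by
  have h1 : S x = S⁺ x - S⁻ x := by
    rw [← sub_apply, CFC.posPart_sub_negPart S hS]
  have hpos : S⁺.IsPositive :=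
    (ContinuousLinearMap.nonneg_iff_isPositive _).1 (CFC.posPart_nonneg S)
  have h2 : inner ℂ (S⁺ x) (S⁻ x) = 0 := by
    have h3 : inner ℂ (S⁺ x) (S⁻ x) = inner ℂ x ((S⁺ * S⁻) x) := hpos.isSymmetric x (S⁻ x)
    rw [h3, CFC.posPart_mul_negPart]
    simp
  rw [h1, @norm_sub_sq ℂ, h2]
  simp

/-- The Dixmier trace of `Re (A D)` is computed by the diagonal sums. -/
theorem dixmierTraceSA_realPart (hD : IsOddReciprocalDiagonal b D)
    (ω : DixmierLimit) (A : E →L[ℂ] E) {l : ℝ}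
    (hl : Tendsto (fun n : ℕ => (∑ k ∈ Finset.range (n + 1),
      (inner ℂ (b k) (A (b k)) / (2 * k + 1)).re) / Real.log (n + 2)) atTop (𝓝 l)) :
    dixmierTraceSA ω (ℜ (A ∘L D) : E →L[ℂ] E) = l := by
  set S : E →L[ℂ] E := (ℜ (A ∘L D) : E →L[ℂ] E) with hSdef
  have hS : IsSelfAdjoint S := (ℜ (A ∘L D)).2
  -- The form of the real part is the real part of the form, so the adjoint of `A ∘L D` drops out of
  -- all diagonal estimates.
  have hre (v : E) : (inner ℂ v (S v)).re = (inner ℂ v (A (D v))).re := by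
    rw [hSdef, realPart_apply_coe, ContinuousLinearMap.star_eq_adjoint]
    simp only [smul_apply, add_apply, ContinuousLinearMap.comp_apply]
    rw [← Complex.coe_smul, inner_smul_right, inner_add_right,
      ContinuousLinearMap.adjoint_inner_right, ContinuousLinearMap.comp_apply,
      ← inner_conj_symm (A (D v)) v, Complex.re_ofReal_mul, Complex.add_re, Complex.conj_re]
    ring
  have hsub : S⁺ - S⁻ = S := CFC.posPart_sub_negPart S hS
  have hp : ∀ x, ‖S⁺ x‖ ≤ ‖S x‖ := fun x => by
    refine le_of_sq_le_sq ?_ (norm_nonneg _)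
    nlinarith [norm_posPart_apply_sq_add hS x]
  have hm : ∀ x, ‖S⁻ x‖ ≤ ‖S x‖ := fun x => by
    refine le_of_sq_le_sq ?_ (norm_nonneg _)
    nlinarith [norm_posPart_apply_sq_add hS x]
  refine dixmierTracePos_sub_eq_of_diagonal ω (C := 2 * ‖A‖) (e := b)
    ((ContinuousLinearMap.nonneg_iff_isPositive _).1 (CFC.posPart_nonneg S))
    ((ContinuousLinearMap.nonneg_iff_isPositive _).1 (CFC.negPart_nonneg S))
    (fun k => (singularValue_le_of_norm_apply_le hp k).trans (singularValue_realPart_le hD A k))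
    (fun k => (singularValue_le_of_norm_apply_le hm k).trans (singularValue_realPart_le hD A k))
    b.orthonormal (fun n hn v hv => ?_) ?_
  · rw [hsub, hre]
    refine (Complex.abs_re_le_norm _).trans ((norm_inner_le_norm _ _).trans ?_)
    have hn' : (0 : ℝ) < n := by exact_mod_cast hn
    have h1 : ‖A (D v)‖ ≤ ‖A‖ * (1 / (2 * (n : ℝ) + 1) * ‖v‖) :=
      (A.le_opNorm _).trans (by gcongr; exact norm_diagonal_apply_le hD hv)
    calc ‖v‖ * ‖A (D v)‖ ≤ ‖v‖ * (‖A‖ * (1 / (2 * (n : ℝ) + 1) * ‖v‖)) := by gcongr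
      _ = ‖A‖ / (2 * n + 1) * ‖v‖ ^ 2 := by ring
      _ ≤ 2 * ‖A‖ / n * ‖v‖ ^ 2 := by
          gcongr
          · linarith [norm_nonneg A]
          · linarith
  · rw [hsub]
    refine hl.congr fun n => ?_
    congr 1
    refine Finset.sum_congr rfl fun k _ => ?_
    rw [hre, diagonal_apply_basis hD, map_smul, inner_smul_right, one_div, inv_mul_eq_div]

/-- The Dixmier trace of `A D` is computed by the diagonal sums. -/
theorem dixmierTrace_comp_diagonal (hD : IsOddReciprocalDiagonal b D)
    (ω : DixmierLimit) (A : E →L[ℂ] E) {l : ℂ}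
    (hl : Tendsto (fun n : ℕ => (∑ k ∈ Finset.range (n + 1),
      inner ℂ (b k) (A (b k)) / (2 * k + 1)) / (Real.log (n + 2) : ℂ)) atTop (𝓝 l)) :
    dixmierTrace ω (A ∘L D) = l := by
  have hre : dixmierTraceSA ω (ℜ (A ∘L D) : E →L[ℂ] E) = l.re := by
    refine dixmierTraceSA_realPart hD ω A ?_
    refine ((Complex.continuous_re.tendsto l).comp hl).congr fun n => ?_
    simp only [Function.comp_apply, Complex.div_ofReal_re, Complex.re_sum]
  have him : dixmierTraceSA ω (ℑ (A ∘L D) : E →L[ℂ] E) = l.im := by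
    -- The imaginary part of `T` is the real part of `-i T`, so the result for real parts applies to
    -- `-i A`.
    have h1 : ℑ (A ∘L D) = ℜ ((-Complex.I • A) ∘L D) := by
      rw [ContinuousLinearMap.smul_comp, neg_smul, map_neg, realPart_I_smul, neg_neg]
    rw [h1]
    refine dixmierTraceSA_realPart hD ω _ ?_
    refine ((Complex.continuous_im.tendsto l).comp hl).congr fun n => ?_
    simp only [Function.comp_apply, Complex.div_ofReal_im, Complex.im_sum]
    congr 1
    refine Finset.sum_congr rfl fun k _ => ?_
    rw [smul_apply, inner_smul_right, mul_div_assoc]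
    simp
  rw [dixmierTrace, hre, him, mul_comm]
  exact Complex.re_add_im l

end Diagonal

/-! ### Polynomials times a Gaussian as Schwartz functions -/

section PolyGauss

open Polynomial

/-- The function `p(x) exp(-x²/2)`. -/
def polyGaussFun (p : ℝ[X]) (x : ℝ) : ℝ := p.eval x * Real.exp (-x ^ 2 / 2)

theorem hasDerivAt_polyGaussFun (p : ℝ[X]) (x : ℝ) :
    HasDerivAt (polyGaussFun p) (polyGaussFun (derivative p - X * p) x) x := by
  have h1 : HasDerivAt (fun x : ℝ => Real.exp (-x ^ 2 / 2)) (Real.exp (-x ^ 2 / 2) * (-x)) x := by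
    have h2 : HasDerivAt (fun x : ℝ => -x ^ 2 / 2) (-x) x := by
      refine ((hasDerivAt_pow 2 x).fun_neg.div_const 2).congr_deriv ?_
      norm_num
      ring
    exact h2.exp
  refine ((p.hasDerivAt x).mul h1).congr_deriv ?_
  simp only [polyGaussFun, eval_sub, eval_mul, eval_X]
  ring

/-- Differentiation acts on the polynomial factor as `q ↦ q' - X q`, so every Schwartz seminorm
reduces to the boundedness of some polynomial times the Gaussian. -/
theorem iteratedDeriv_polyGaussFun (n : ℕ) (p : ℝ[X]) :
    iteratedDeriv n (fun x => (polyGaussFun p x : ℂ))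
      = fun x => (polyGaussFun ((fun q => derivative q - X * q)^[n] p) x : ℂ) := by
  induction n generalizing p with
  | zero => rfl
  | succ n ih =>
    rw [iteratedDeriv_succ', Function.iterate_succ_apply, ← ih]
    congr 1
    ext x
    exact (hasDerivAt_polyGaussFun p x).ofReal_comp.deriv

theorem exists_abs_polyGaussFun_le (p : ℝ[X]) : ∃ C, ∀ x, |polyGaussFun p x| ≤ C := by
  induction p using Polynomial.induction_on' with
  | add p q hp hq =>
    obtain ⟨C, hC⟩ := hp
    obtain ⟨C', hC'⟩ := hq
    refine ⟨C + C', fun x => ?_⟩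
    have : polyGaussFun (p + q) x = polyGaussFun p x + polyGaussFun q x := by
      simp [polyGaussFun, add_mul]
    rw [this]
    exact (abs_add_le _ _).trans (add_le_add (hC x) (hC' x))
  | monomial k a =>
    -- The constant comes from `|x|ᵏ ≤ 1 + x²ᵏ` and one term of the exponential series at `x² / 2`.
    refine ⟨|a| * (1 + 2 ^ k * k.factorial), fun x => ?_⟩
    have h1 : |x| ^ k ≤ 1 + (x ^ 2) ^ k := by
      rw [← sq_abs x, ← pow_mul, mul_comm, pow_mul]
      nlinarith [sq_nonneg (|x| ^ k - 1)]
    have h2 := Real.pow_div_factorial_le_exp (x ^ 2 / 2) (by positivity) k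
    rw [div_pow, div_div, div_le_iff₀ (by positivity)] at h2
    have h3 : 1 ≤ Real.exp (x ^ 2 / 2) := Real.one_le_exp (by positivity)
    have h4 : |x| ^ k ≤ (1 + 2 ^ k * k.factorial) * Real.exp (x ^ 2 / 2) := by linarith
    rw [polyGaussFun, eval_monomial, abs_mul, abs_mul, Real.abs_exp, abs_pow, mul_assoc]
    gcongr
    rw [neg_div, Real.exp_neg, ← div_eq_mul_inv, div_le_iff₀ (Real.exp_pos _)]
    exact h4

theorem contDiff_polyGaussFun (p : ℝ[X]) : ContDiff ℝ (⊤ : ℕ∞) (polyGaussFun p) := by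
  have h : ContDiff ℝ (⊤ : ℕ∞) (fun x : ℝ => p.eval x) := by
    simpa using p.contDiff_aeval (𝕜 := ℝ) (⊤ : ℕ∞)
  exact h.mul ((contDiff_id.pow 2).neg.div_const 2).exp

/-- `p(x) exp(-x²/2)` as a Schwartz function. -/
def polyGauss (p : ℝ[X]) : 𝓢(ℝ, ℂ) where
  toFun x := (polyGaussFun p x : ℂ)
  smooth' := Complex.ofRealCLM.contDiff.comp (contDiff_polyGaussFun p)
  decay' k n := by
    set q := (fun q => derivative q - X * q)^[n] p with hq
    obtain ⟨C, hC⟩ := exists_abs_polyGaussFun_le (X ^ k * q)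
    refine ⟨C, fun x => ?_⟩
    rw [norm_iteratedFDeriv_eq_norm_iteratedDeriv, iteratedDeriv_polyGaussFun, ← hq]
    refine le_trans (le_of_eq ?_) (hC x)
    rw [Complex.norm_real, polyGaussFun, polyGaussFun, eval_mul, eval_pow, eval_X, mul_assoc,
      abs_mul (x ^ k), abs_pow, Real.norm_eq_abs, Real.norm_eq_abs]

@[simp] theorem polyGauss_apply (p : ℝ[X]) (x : ℝ) : polyGauss p x = (polyGaussFun p x : ℂ) := rfl

theorem deriv_polyGauss (p : ℝ[X]) : deriv (polyGauss p) = polyGauss (derivative p - X * p) := by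
  ext x
  exact (hasDerivAt_polyGaussFun p x).ofReal_comp.deriv

theorem schwartzOscillator_polyGauss (p : ℝ[X]) :
    schwartzOscillator (polyGauss p)
      = polyGauss (p + 2 * X * derivative p - derivative (derivative p)) := by
  ext x
  rw [schwartzOscillator_apply, deriv_polyGauss, deriv_polyGauss]
  simp only [polyGauss_apply, polyGaussFun]
  simp only [derivative_sub, derivative_mul, derivative_X, eval_sub, eval_add, eval_mul, eval_X,
    eval_one, eval_ofNat]
  push_cast
  ring

theorem polyGauss_add (p q : ℝ[X]) : polyGauss (p + q) = polyGauss p + polyGauss q := by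
  ext x; simp [polyGaussFun, add_mul]

theorem polyGauss_smul (a : ℝ) (p : ℝ[X]) : polyGauss (a • p) = (a : ℂ) • polyGauss p := by
  ext x; simp [polyGaussFun, mul_assoc]

/-! ### Pairings -/

theorem integral_schwartz_mul_deriv (φ ψ : 𝓢(ℝ, ℂ)) :
    ∫ x, φ x * deriv ψ x = -∫ x, deriv φ x * ψ x :=
  SchwartzMap.integral_mul_deriv_eq_neg_deriv_mul φ ψ

/-- The pairing `∫ p q exp(-x²)`. -/
def gaussPairing (p q : ℝ[X]) : ℂ := ∫ x, polyGauss p x * polyGauss q x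

theorem gaussPairing_X_mul (p q : ℝ[X]) : gaussPairing (X * p) q = gaussPairing p (X * q) := by
  unfold gaussPairing
  congr 1
  ext x
  simp only [polyGauss_apply, polyGaussFun, eval_mul, eval_X]
  push_cast
  ring

theorem integrable_schwartz_mul (φ ψ : 𝓢(ℝ, ℂ)) : Integrable fun x => φ x * ψ x := by
  have := (SchwartzMap.memLp φ 2 volume).integrable_mul (SchwartzMap.memLp ψ 2 volume)
  exact this

theorem gaussPairing_add_right (p q q' : ℝ[X]) :
    gaussPairing p (q + q') = gaussPairing p q + gaussPairing p q' := by
  unfold gaussPairing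
  rw [← integral_add (integrable_schwartz_mul _ _) (integrable_schwartz_mul _ _)]
  simp [polyGauss_add, mul_add]

theorem gaussPairing_comm (p q : ℝ[X]) : gaussPairing p q = gaussPairing q p := by
  simp only [gaussPairing, mul_comm]

theorem gaussPairing_smul_right (a : ℝ) (p q : ℝ[X]) :
    gaussPairing p (a • q) = a * gaussPairing p q := by
  unfold gaussPairing
  rw [← integral_const_mul]
  simp [polyGauss_smul, mul_left_comm]

/-- Integration by parts: for the weight `exp(-x²)` the raising operator `2X - d/dx` is the
transpose of the lowering operator `d/dx`. -/
theorem gaussPairing_adjoint (p q : ℝ[X]) :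
    gaussPairing p (2 * X * q - derivative q) = gaussPairing (derivative p) q := by
  have h := integral_schwartz_mul_deriv (polyGauss p) (polyGauss q)
  rw [deriv_polyGauss, deriv_polyGauss] at h
  change gaussPairing p _ = -gaussPairing _ q at h
  have h1 : 2 * X * q - derivative q = X * q + (-1 : ℝ) • (derivative q - X * q) := by
    rw [neg_one_smul]; ring
  have h2 : gaussPairing (derivative p) q
      = gaussPairing (derivative p - X * p) q + gaussPairing (X * p) q := by
    rw [gaussPairing_comm _ q, gaussPairing_comm _ q, gaussPairing_comm _ q,
      ← gaussPairing_add_right, sub_add_cancel]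
  rw [h1, gaussPairing_add_right, gaussPairing_smul_right, h, h2, gaussPairing_X_mul]
  push_cast
  ring

theorem gaussPairing_one_one : gaussPairing 1 1 = (√Real.pi : ℝ) := by
  have h := integral_gaussian 1
  rw [div_one] at h
  rw [gaussPairing, ← h, ← integral_complex_ofReal]
  congr 1
  ext x
  simp only [polyGauss_apply, polyGaussFun, eval_one, one_mul]
  rw [← Complex.ofReal_mul, ← Real.exp_add]
  congr 2
  ring

/-! ### Hermite polynomials -/

/-- The Hermite polynomials `1, 2x, 4x² - 2, …`, orthogonal for the weight `exp(-x²)`. -/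
def hermitePoly : ℕ → ℝ[X]
  | 0 => 1
  | n + 1 => 2 * X * hermitePoly n - derivative (hermitePoly n)

theorem hermitePoly_succ (n : ℕ) :
    hermitePoly (n + 1) = 2 * X * hermitePoly n - derivative (hermitePoly n) := rfl

theorem derivative_hermitePoly_succ (n : ℕ) :
    derivative (hermitePoly (n + 1)) = (2 * (n + 1) : ℝ) • hermitePoly n := by
  induction n with
  | zero => simp [hermitePoly, smul_eq_C_mul, ← C_ofNat]
  | succ n ih =>
    rw [hermitePoly_succ (n + 1), derivative_sub, derivative_mul, ih, derivative_smul]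
    have h2 : derivative (2 * X : ℝ[X]) = 2 := by simp
    rw [h2, mul_smul_comm, add_sub_assoc, ← smul_sub, ← hermitePoly_succ]
    simp only [smul_eq_C_mul]
    push_cast
    simp only [map_mul, map_add, map_one, C_ofNat]
    ring

theorem hermitePoly_succ_succ (n : ℕ) :
    hermitePoly (n + 2) = 2 * X * hermitePoly (n + 1) - (2 * (n + 1) : ℝ) • hermitePoly n := by
  rw [hermitePoly_succ (n + 1), derivative_hermitePoly_succ]

/-- Hermite's equation: lowering and then raising multiplies by `2n`. With
`schwartzOscillator_polyGauss` it yields the eigenvalue `2n + 1`. -/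
theorem hermitePoly_ode (n : ℕ) :
    hermitePoly n + 2 * X * derivative (hermitePoly n) - derivative (derivative (hermitePoly n))
      = (2 * n + 1 : ℝ) • hermitePoly n := by
  cases n with
  | zero => simp [hermitePoly]
  | succ n =>
    rw [derivative_hermitePoly_succ, derivative_smul, mul_smul_comm, add_sub_assoc, ← smul_sub,
      ← hermitePoly_succ]
    simp only [smul_eq_C_mul]
    push_cast
    simp only [map_mul, map_add, map_one, C_ofNat]
    ring

/-- Moving the raising operator across lowers both indices, which reduces orthogonality and norms to
index zero. -/
theorem gaussPairing_hermitePoly_succ_succ (m n : ℕ) :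
    gaussPairing (hermitePoly (m + 1)) (hermitePoly (n + 1))
      = (2 * (m + 1) : ℝ) * gaussPairing (hermitePoly m) (hermitePoly n) := by
  rw [hermitePoly_succ n, gaussPairing_adjoint, derivative_hermitePoly_succ, gaussPairing_comm,
    gaussPairing_smul_right, gaussPairing_comm]

theorem gaussPairing_hermitePoly_zero_succ (n : ℕ) :
    gaussPairing (hermitePoly 0) (hermitePoly (n + 1)) = 0 := by
  rw [hermitePoly_succ n, gaussPairing_adjoint, hermitePoly, derivative_one]
  simp [gaussPairing, polyGaussFun]

theorem gaussPairing_hermitePoly_of_ne {m n : ℕ} (h : m ≠ n) :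
    gaussPairing (hermitePoly m) (hermitePoly n) = 0 := by
  induction m generalizing n with
  | zero =>
    obtain ⟨n, rfl⟩ := Nat.exists_eq_succ_of_ne_zero h.symm
    exact gaussPairing_hermitePoly_zero_succ n
  | succ m ih =>
    cases n with
    | zero => rw [gaussPairing_comm]; exact gaussPairing_hermitePoly_zero_succ m
    | succ n => rw [gaussPairing_hermitePoly_succ_succ, ih (by omega), mul_zero]

theorem gaussPairing_hermitePoly_self (n : ℕ) :
    gaussPairing (hermitePoly n) (hermitePoly n) = (√Real.pi * (2 ^ n * n.factorial) : ℝ) := by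
  induction n with
  | zero => simpa [hermitePoly] using gaussPairing_one_one
  | succ n ih =>
    rw [gaussPairing_hermitePoly_succ_succ, ih, Nat.factorial_succ]
    push_cast
    ring

/-- The span contains the constants and is stable under multiplication by `X`, since `X Hₙ = (Hₙ₊₁ +
Hₙ') / 2`. -/
theorem span_hermitePoly : Submodule.span ℝ (Set.range hermitePoly) = ⊤ := by
  set S := Submodule.span ℝ (Set.range hermitePoly)
  have hmem (n) : hermitePoly n ∈ S := Submodule.subset_span ⟨n, rfl⟩
  have hX (p : ℝ[X]) (hp : p ∈ S) : X * p ∈ S := by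
    induction hp using Submodule.span_induction with
    | mem p hp =>
      obtain ⟨n, rfl⟩ := hp
      have hd : derivative (hermitePoly n) ∈ S := by
        cases n with
        | zero => simp [hermitePoly]
        | succ n =>
          rw [derivative_hermitePoly_succ]
          exact S.smul_mem _ (hmem n)
      have : X * hermitePoly n
          = (1 / 2 : ℝ) • (hermitePoly (n + 1) + derivative (hermitePoly n)) := by
        rw [hermitePoly_succ, sub_add_cancel, mul_assoc, smul_eq_C_mul, ← mul_assoc,
          ← C_ofNat, ← C_mul]
        norm_num
      rw [this]
      exact S.smul_mem _ (S.add_mem (hmem _) hd)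
    | zero => simp
    | add p q _ _ hp hq => rw [mul_add]; exact S.add_mem hp hq
    | smul a p _ hp => rw [mul_smul_comm]; exact S.smul_mem a hp
  rw [Submodule.eq_top_iff']
  intro p
  induction p using Polynomial.induction_on with
  | C a =>
    have := S.smul_mem a (hmem 0)
    rwa [hermitePoly, smul_eq_C_mul, mul_one] at this
  | add p q hp hq => exact S.add_mem hp hq
  | monomial n a h =>
    have := hX _ h
    rwa [mul_left_comm, ← pow_succ'] at this

end PolyGauss

section HermiteBasis

open Polynomial

/-! ### The Hermite functions -/

theorem coeFn_schwartzToL2 (φ : 𝓢(ℝ, ℂ)) : schwartzToL2 φ =ᵐ[volume] φ :=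
  φ.coeFn_toLp 2 volume

theorem inner_polyGauss (p : ℝ[X]) (v : L2) :
    inner ℂ (schwartzToL2 (polyGauss p)) v = ∫ x, polyGauss p x * v x := by
  rw [L2.inner_def]
  refine integral_congr_ae ?_
  filter_upwards [coeFn_schwartzToL2 (polyGauss p)] with x hx
  rw [hx, RCLike.inner_apply, polyGauss_apply, Complex.conj_ofReal, mul_comm]

theorem inner_polyGauss_schwartz (p : ℝ[X]) (ψ : 𝓢(ℝ, ℂ)) :
    inner ℂ (schwartzToL2 (polyGauss p)) (schwartzToL2 ψ) = ∫ x, polyGauss p x * ψ x := by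
  rw [inner_polyGauss]
  refine integral_congr_ae ?_
  filter_upwards [coeFn_schwartzToL2 ψ] with x hx
  rw [hx]

/-- The normalization constant of the `n`-th Hermite function. -/
def hermiteNorm (n : ℕ) : ℝ := √(√Real.pi * (2 ^ n * n.factorial))

theorem hermiteNorm_pos (n : ℕ) : 0 < hermiteNorm n := by
  unfold hermiteNorm
  positivity

theorem hermiteNorm_sq (n : ℕ) : hermiteNorm n ^ 2 = √Real.pi * (2 ^ n * n.factorial) :=
  Real.sq_sqrt (by positivity)

/-- The `n`-th normalized Hermite function. -/
def hermiteFun (n : ℕ) : 𝓢(ℝ, ℂ) := polyGauss ((hermiteNorm n)⁻¹ • hermitePoly n)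

theorem orthonormal_hermiteFun : Orthonormal ℂ fun n => schwartzToL2 (hermiteFun n) := by
  rw [orthonormal_iff_ite]
  intro m n
  have h : inner ℂ (schwartzToL2 (hermiteFun m)) (schwartzToL2 (hermiteFun n))
      = ((hermiteNorm n)⁻¹ * (hermiteNorm m)⁻¹ : ℝ)
        * gaussPairing (hermitePoly m) (hermitePoly n) := by
    rw [hermiteFun, inner_polyGauss_schwartz]
    change gaussPairing _ _ = _
    rw [gaussPairing_smul_right, gaussPairing_comm, gaussPairing_smul_right, gaussPairing_comm]
    push_cast
    ring
  rw [h]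
  split_ifs with hmn
  · subst hmn
    rw [gaussPairing_hermitePoly_self, ← hermiteNorm_sq, ← Complex.ofReal_mul]
    have := (hermiteNorm_pos m).ne'
    rw [← Complex.ofReal_one]
    congr 1
    field_simp
  · rw [gaussPairing_hermitePoly_of_ne hmn, mul_zero]

theorem schwartzOscillator_hermiteFun (n : ℕ) :
    schwartzOscillator (hermiteFun n) = (2 * n + 1 : ℂ) • hermiteFun n := by
  have h1 (a : ℝ) (p : ℝ[X]) : polyGauss (a • p) = (a : ℂ) • polyGauss p := polyGauss_smul a p
  rw [hermiteFun, h1, map_smul, schwartzOscillator_polyGauss, hermitePoly_ode, h1, smul_comm]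
  push_cast
  rfl

theorem integral_polyGauss_mul_schwartzOscillator (p : ℝ[X]) (ψ : 𝓢(ℝ, ℂ)) :
    ∫ x, polyGauss p x * schwartzOscillator ψ x
      = ∫ x, schwartzOscillator (polyGauss p) x * ψ x := by
  have hd (φ : 𝓢(ℝ, ℂ)) : ⇑(SchwartzMap.derivCLM ℂ ℂ φ) = deriv φ := by ext y; simp
  have h1 := integral_schwartz_mul_deriv (polyGauss p) (SchwartzMap.derivCLM ℂ ℂ ψ)
  have h2 := integral_schwartz_mul_deriv (SchwartzMap.derivCLM ℂ ℂ (polyGauss p)) ψ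
  set x2 : 𝓢(ℝ, ℂ) →L[ℂ] 𝓢(ℝ, ℂ) := SchwartzMap.smulLeftCLM ℂ (fun x : ℝ => ((x : ℂ) ^ 2))
  have hx2 (φ : 𝓢(ℝ, ℂ)) (x : ℝ) : x2 φ x = (x : ℂ) ^ 2 * φ x := by
    have h : (fun x : ℝ => ((x : ℂ) ^ 2)).HasTemperateGrowth := by fun_prop
    simp [x2, SchwartzMap.smulLeftCLM_apply_apply h]
  rw [hd] at h1 h2
  have i1 := integrable_schwartz_mul (polyGauss p)
    (SchwartzMap.derivCLM ℂ ℂ (SchwartzMap.derivCLM ℂ ℂ ψ))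
  have i2 := integrable_schwartz_mul (polyGauss p) (x2 ψ)
  have i3 := integrable_schwartz_mul
    (SchwartzMap.derivCLM ℂ ℂ (SchwartzMap.derivCLM ℂ ℂ (polyGauss p))) ψ
  have i4 := integrable_schwartz_mul (x2 (polyGauss p)) ψ
  rw [hd, hd] at i1 i3
  have e1 : ∫ x, polyGauss p x * schwartzOscillator ψ x
      = -(∫ x, polyGauss p x * deriv (deriv ψ) x) + ∫ x, polyGauss p x * x2 ψ x := by
    rw [← integral_neg, ← integral_add i1.fun_neg i2]
    refine integral_congr_ae (Eventually.of_forall fun x => ?_)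
    simp only [schwartzOscillator_apply, hx2]
    ring
  have e2 : ∫ x, schwartzOscillator (polyGauss p) x * ψ x
      = -(∫ x, deriv (deriv (polyGauss p)) x * ψ x) + ∫ x, x2 (polyGauss p) x * ψ x := by
    rw [← integral_neg, ← integral_add i3.fun_neg i4]
    refine integral_congr_ae (Eventually.of_forall fun x => ?_)
    simp only [schwartzOscillator_apply, hx2]
    ring
  rw [e1, e2, h1, h2, neg_neg]
  congr 2
  ext x
  rw [hx2, hx2]
  ring

/-- The symmetry is needed against every Schwartz function, because the whole Schwartz space is the
domain whose graph is closed. -/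
theorem inner_hermiteFun_schwartzOscillator (n : ℕ) (ψ : 𝓢(ℝ, ℂ)) :
    inner ℂ (schwartzToL2 (hermiteFun n)) (schwartzToL2 (schwartzOscillator ψ))
      = (2 * n + 1 : ℂ) * inner ℂ (schwartzToL2 (hermiteFun n)) (schwartzToL2 ψ) := by
  have h := schwartzOscillator_hermiteFun n
  rw [hermiteFun] at h ⊢
  rw [inner_polyGauss_schwartz, integral_polyGauss_mul_schwartzOscillator, h,
    inner_polyGauss_schwartz, ← integral_const_mul]
  congr 1
  ext x
  rw [smul_apply, smul_eq_mul, mul_assoc]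

/-! ### Completeness -/

/-- Injectivity of the Fourier transform on integrable functions: each test function is the
transform of a Schwartz function `ψ`, and the transform can be moved from `ψ` to `h`. -/
theorem ae_eq_zero_of_fourier_eq_zero {h : ℝ → ℂ} (hi : Integrable h)
    (h0 : ∀ w : ℝ, ∫ x : ℝ, Complex.exp (((-2 * Real.pi * x * w : ℝ) : ℂ) * Complex.I) * h x = 0) :
    ∀ᵐ x, h x = 0 := by
  refine ae_eq_zero_of_integral_contDiff_smul_eq_zero hi.locallyIntegrable fun g hg hgc => ?_
  have hgc' : HasCompactSupport fun x => (g x : ℂ) := hgc.comp_left Complex.ofReal_zero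
  have hg' : ContDiff ℝ (⊤ : ℕ∞) fun x => (g x : ℂ) := Complex.ofRealCLM.contDiff.comp hg
  let G : 𝓢(ℝ, ℂ) := hgc'.toSchwartzMap hg'
  let ψ : 𝓢(ℝ, ℂ) := FourierTransformInv.fourierInv G
  have hψ : FourierTransform.fourier ψ = G := FourierTransform.fourier_fourierInv_eq G
  have hF : FourierTransform.fourier h = 0 := by
    ext w
    rw [Real.fourier_real_eq_integral_exp_smul]
    exact h0 w
  have key := VectorFourier.integral_fourierIntegral_smul_eq_flip (L := innerₗ ℝ)
    Real.continuous_fourierChar continuous_inner hi (SchwartzMap.integrable (μ := volume) ψ)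
  have hl : VectorFourier.fourierIntegral Real.fourierChar volume (innerₗ ℝ) h = 0 := hF
  have hr : VectorFourier.fourierIntegral Real.fourierChar volume (innerₗ ℝ).flip ψ = G := by
    rw [flip_innerₗ]
    exact congrArg DFunLike.coe hψ
  rw [hl, hr] at key
  simp only [Pi.zero_apply, smul_eq_mul, zero_mul, integral_zero] at key
  rw [key]
  congr 1
  ext x
  rw [Complex.real_smul, mul_comm]
  rfl

theorem integrable_exp_neg_sq_mul {v : ℝ → ℂ} (hv : MemLp v 2) (s : ℝ) :
    Integrable fun x : ℝ => Real.exp (|s * x|) * Real.exp (-x ^ 2 / 2) * ‖v x‖ := by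
  have h1 : MemLp (fun x : ℝ => Real.exp (-x ^ 2 / 4)) 2 := by
    rw [memLp_two_iff_integrable_sq (by fun_prop)]
    refine (integrable_exp_neg_mul_sq (b := 1 / 2) (by norm_num)).congr
      (Eventually.of_forall fun x => ?_)
    simp only
    rw [← Real.exp_nat_mul]
    congr 1
    push_cast
    ring
  -- From `|s x| ≤ s² + x²/4`: half of the Gaussian exponent pays for the exponential, and the
  -- remaining `exp(-x²/4)` is square integrable against `v`.
  have h2 := (h1.integrable_mul hv.norm).const_mul (Real.exp (s ^ 2))
  refine h2.mono' (by
    refine (Continuous.aestronglyMeasurable (by fun_prop)).mul hv.1.norm)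
    (Eventually.of_forall fun x => ?_)
  simp only [Pi.mul_apply]
  rw [Real.norm_of_nonneg (by positivity), ← mul_assoc, ← Real.exp_add, ← Real.exp_add]
  refine mul_le_mul_of_nonneg_right (Real.exp_le_exp.2 ?_) (norm_nonneg _)
  rw [abs_mul]
  nlinarith [sq_nonneg (|s| - |x| / 2), sq_abs s, sq_abs x]

/-- All moments of `h = exp(-x²/2) v` vanish. Expanding the exponential termwise, dominated by `exp
|s x|`, shows that the Fourier transform of `h` vanishes. -/
theorem ae_eq_zero_of_integral_polyGauss {v : ℝ → ℂ} (hv : MemLp v 2)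
    (h0 : ∀ p : ℝ[X], ∫ x, polyGauss p x * v x = 0) : ∀ᵐ x, v x = 0 := by
  set h : ℝ → ℂ := fun x => (Real.exp (-x ^ 2 / 2) : ℂ) * v x with hh
  have hmeas : AEStronglyMeasurable h :=
    (Continuous.aestronglyMeasurable (by fun_prop)).mul hv.1
  have hn (x : ℝ) : ‖h x‖ = Real.exp (-x ^ 2 / 2) * ‖v x‖ := by
    rw [hh, norm_mul, Complex.norm_real, Real.norm_of_nonneg (Real.exp_pos _).le]
  have hi : Integrable h := by
    refine (integrable_exp_neg_sq_mul hv 0).mono' hmeas (Eventually.of_forall fun x => ?_)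
    simp [hn]
  have key : ∀ᵐ x, h x = 0 := by
    refine ae_eq_zero_of_fourier_eq_zero hi fun w => ?_
    set s : ℝ := -2 * Real.pi * w with hs
    have hsum : HasSum
        (fun n : ℕ => ∫ x : ℝ, (((s * x : ℝ) : ℂ) * Complex.I) ^ n / n.factorial * h x)
        (∫ x : ℝ, Complex.exp (((s * x : ℝ) : ℂ) * Complex.I) * h x) := by
      refine hasSum_integral_of_dominated_convergence
        (fun n x => |s * x| ^ n / n.factorial * ‖h x‖) (fun n => ?_)
        (fun n => Eventually.of_forall fun x => ?_) (Eventually.of_forall fun x => ?_) ?_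
        (Eventually.of_forall fun x => ?_)
      · exact (Continuous.aestronglyMeasurable (by fun_prop)).mul hmeas
      · simp
      · exact (Real.summable_pow_div_factorial _).mul_right _
      · have he (x : ℝ) : ∑' n : ℕ, |s * x| ^ n / n.factorial * ‖h x‖
            = Real.exp |s * x| * Real.exp (-x ^ 2 / 2) * ‖v x‖ := by
          rw [tsum_mul_right, hn, ← mul_assoc, Real.exp_eq_exp_ℝ,
            (NormedSpace.expSeries_div_hasSum_exp |s * x|).tsum_eq]
        simp_rw [he]
        exact integrable_exp_neg_sq_mul hv s
      · refine HasSum.mul_right _ ?_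
        rw [Complex.exp_eq_exp_ℂ]
        exact NormedSpace.expSeries_div_hasSum_exp _
    have hz (n : ℕ) : ∫ x : ℝ, (((s * x : ℝ) : ℂ) * Complex.I) ^ n / n.factorial * h x = 0 := by
      have h1 := h0 (X ^ n)
      have h2 : ∀ x : ℝ, (((s * x : ℝ) : ℂ) * Complex.I) ^ n / n.factorial * h x
          = ((s : ℂ) * Complex.I) ^ n / n.factorial * (polyGauss (X ^ n) x * v x) := by
        intro x
        simp only [hh, polyGauss_apply, polyGaussFun, eval_pow, eval_X]
        push_cast
        ring
      simp_rw [h2]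
      rw [integral_const_mul, h1, mul_zero]
    simp_rw [hz] at hsum
    have := hsum.unique hasSum_zero
    rw [← this]
    congr 1
    ext x
    rw [hs]
    congr 4
    ring
  filter_upwards [key] with x hx
  rw [hh] at hx
  exact (mul_eq_zero.1 hx).resolve_left (by simp)

theorem span_hermiteFun_orthogonal :
    (Submodule.span ℂ (Set.range fun n => schwartzToL2 (hermiteFun n)))ᗮ = ⊥ := by
  rw [Submodule.eq_bot_iff]
  intro v hv
  have h1 (n : ℕ) : inner ℂ (schwartzToL2 (polyGauss (hermitePoly n))) v = 0 := by
    have h2 : inner ℂ (schwartzToL2 (hermiteFun n)) v = 0 :=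
      hv _ (Submodule.subset_span ⟨n, rfl⟩)
    rw [hermiteFun, polyGauss_smul, map_smul, inner_smul_left] at h2
    refine (mul_eq_zero.1 h2).resolve_left ?_
    simpa using (hermiteNorm_pos n).ne'
  have h2 (p : ℝ[X]) : inner ℂ (schwartzToL2 (polyGauss p)) v = 0 := by
    have hp : p ∈ Submodule.span ℝ (Set.range hermitePoly) := by rw [span_hermitePoly]; trivial
    induction hp using Submodule.span_induction with
    | mem p hp => obtain ⟨n, rfl⟩ := hp; exact h1 n
    | zero => rw [← zero_smul ℝ (0 : ℝ[X]), polyGauss_smul]; simp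
    | add p q _ _ hp hq => rw [polyGauss_add, map_add, inner_add_left, hp, hq, add_zero]
    | smul a p _ hp => rw [polyGauss_smul, map_smul, inner_smul_left, hp, mul_zero]
  have h3 : ∀ᵐ x, (v : ℝ → ℂ) x = 0 :=
    ae_eq_zero_of_integral_polyGauss (Lp.memLp v) fun p => by rw [← inner_polyGauss, h2]
  exact (Lp.eq_zero_iff_ae_eq_zero).2 h3

/-- The Hilbert basis of Hermite functions. -/
def hermiteBasis : HilbertBasis ℕ ℂ L2 :=
  HilbertBasis.mkOfOrthogonalEqBot orthonormal_hermiteFun span_hermiteFun_orthogonal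

theorem hermiteBasis_apply (n : ℕ) : hermiteBasis n = schwartzToL2 (hermiteFun n) := by
  rw [hermiteBasis, HilbertBasis.coe_mkOfOrthogonalEqBot]

/-! ### The inverse of the harmonic oscillator -/

theorem mem_graph_oscillatorOnSchwartz {z : L2 × L2} : z ∈ oscillatorOnSchwartz.graph ↔
    ∃ ψ : 𝓢(ℝ, ℂ), z = (schwartzToL2 ψ, schwartzToL2 (schwartzOscillator ψ)) := by
  rw [LinearPMap.mem_graph_iff']
  have hval (ψ : 𝓢(ℝ, ℂ)) (h : schwartzToL2 ψ ∈ oscillatorOnSchwartz.domain) :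
      oscillatorOnSchwartz ⟨schwartzToL2 ψ, h⟩ = schwartzToL2 (schwartzOscillator ψ) := by
    have h2 : (LinearEquiv.ofInjective schwartzToL2 schwartzToL2_injective).symm
        ⟨schwartzToL2 ψ, h⟩ = ψ := by
      rw [LinearEquiv.symm_apply_eq]
      rfl
    change schwartzToL2 (schwartzOscillator ((LinearEquiv.ofInjective schwartzToL2
      schwartzToL2_injective).symm ⟨schwartzToL2 ψ, h⟩)) = _
    rw [h2]
  constructor
  · rintro ⟨⟨_, ψ, rfl⟩, rfl⟩
    exact ⟨ψ, Prod.ext rfl (hval ψ _)⟩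
  · rintro ⟨ψ, rfl⟩
    exact ⟨⟨schwartzToL2 ψ, ψ, rfl⟩, Prod.ext rfl (hval ψ _)⟩

/-- The transposed graph `Γ` of `D` is closed and contains the graph on Schwartz functions by
symmetry; conversely the Hermite eigenvectors make that graph dense in `Γ`. As `D` is injective, `Γ`
is itself the graph of an operator, namely the closure. -/
theorem isBoundedInverse_of_diagonal {D : L2 →L[ℂ] L2}
    (hD : IsOddReciprocalDiagonal hermiteBasis D) : IsBoundedInverse harmonicOscillator D := by
  have hne (k : ℕ) : (2 * k + 1 : ℂ) ≠ 0 := by exact_mod_cast (2 * k).succ_ne_zero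
  set Γ : Submodule ℂ (L2 × L2) :=
    LinearMap.ker ((D : L2 →ₗ[ℂ] L2) ∘ₗ LinearMap.snd ℂ L2 L2 - LinearMap.fst ℂ L2 L2) with hΓ
  have hmem (z : L2 × L2) : z ∈ Γ ↔ D z.2 = z.1 := by
    simp [hΓ, sub_eq_zero]
  have hclosed : IsClosed (Γ : Set (L2 × L2)) := by
    have : (Γ : Set (L2 × L2)) = {z | D z.2 = z.1} := by ext z; exact hmem z
    rw [this]
    exact isClosed_eq (by fun_prop) (by fun_prop)
  have hle : oscillatorOnSchwartz.graph ≤ Γ := by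
    intro z hz
    obtain ⟨ψ, rfl⟩ := mem_graph_oscillatorOnSchwartz.1 hz
    rw [hmem]
    refine hermiteBasis.ext_inner fun k => ?_
    rw [hD, hermiteBasis_apply, inner_hermiteFun_schwartzOscillator, ← mul_assoc, one_div,
      inv_mul_cancel₀ (hne k), one_mul]
  have hge : Γ ≤ oscillatorOnSchwartz.graph.topologicalClosure := by
    -- `G` consists of the `v` with `(D v, v)` in the closed graph. It is a closed subspace
    -- containing the Hermite basis, hence everything.
    let G : Submodule ℂ L2 := oscillatorOnSchwartz.graph.topologicalClosure.comap
      ((D : L2 →ₗ[ℂ] L2).prod LinearMap.id)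
    have hGc : IsClosed (G : Set L2) :=
      (Submodule.isClosed_topologicalClosure _).preimage (D.continuous.prodMk continuous_id)
    have hspan : Submodule.span ℂ (Set.range hermiteBasis) ≤ G := by
      rw [Submodule.span_le]
      rintro _ ⟨k, rfl⟩
      refine Submodule.le_topologicalClosure _ (mem_graph_oscillatorOnSchwartz.2
        ⟨(1 / (2 * k + 1) : ℂ) • hermiteFun k, ?_⟩)
      refine Prod.ext ?_ ?_
      · change D (hermiteBasis k) = _
        rw [diagonal_apply_basis hD, hermiteBasis_apply, map_smul]
      · change hermiteBasis k
          = schwartzToL2 (schwartzOscillator ((1 / (2 * k + 1) : ℂ) • hermiteFun k))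
        rw [hermiteBasis_apply, map_smul, schwartzOscillator_hermiteFun, smul_smul, one_div,
          inv_mul_cancel₀ (hne k), one_smul]
    have htop : G = ⊤ := by
      have := Submodule.topologicalClosure_minimal _ hspan hGc
      rwa [hermiteBasis.dense_span, top_le_iff] at this
    intro z hz
    have h1 : z.2 ∈ G := by rw [htop]; trivial
    have h2 : z = (D z.2, z.2) := Prod.ext ((hmem z).1 hz).symm rfl
    rw [h2]
    exact h1
  have hclosure : oscillatorOnSchwartz.graph.topologicalClosure = Γ :=
    le_antisymm (Submodule.topologicalClosure_minimal _ hle hclosed) hge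
  have hinj (z : L2 × L2) (hz : z ∈ Γ) (h0 : z.1 = 0) : z.2 = 0 := by
    rw [hmem, h0] at hz
    refine hermiteBasis.ext_inner fun k => ?_
    have h1 := hD k z.2
    rw [hz, inner_zero_right] at h1
    rw [inner_zero_right]
    exact (mul_eq_zero.1 h1.symm).resolve_left (one_div_ne_zero (hne k))
  have hclosable : oscillatorOnSchwartz.IsClosable :=
    ⟨Γ.toLinearPMap, by rw [hclosure, Submodule.toLinearPMap_graph_eq Γ hinj]⟩
  intro u v
  rw [harmonicOscillator, ← hclosable.graph_closure_eq_closure_graph, hclosure, hmem]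

theorem IsBoundedInverse.unique {A : L2 →ₗ.[ℂ] L2} {R R' : L2 →L[ℂ] L2}
    (h : IsBoundedInverse A R) (h' : IsBoundedInverse A R') : R = R' := by
  ext1 v
  exact (h' (R v) v).1 ((h (R v) v).2 rfl) |>.symm

theorem isOddReciprocalDiagonal_oscillatorInv :
    IsOddReciprocalDiagonal hermiteBasis oscillatorInv := by
  obtain ⟨D, hD⟩ := exists_diagonal hermiteBasis (c := fun k => (1 / (2 * k + 1) : ℂ)) fun k => by
    rw [norm_two_mul_add_one_inv, div_le_one (by positivity)]
    have : (0 : ℝ) ≤ k := by positivity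
    linarith
  have hex : ∃ R : L2 →L[ℂ] L2, IsBoundedInverse harmonicOscillator R :=
    ⟨D, isBoundedInverse_of_diagonal hD⟩
  have : oscillatorInv = D := by
    rw [oscillatorInv, dif_pos hex]
    exact hex.choose_spec.unique (isBoundedInverse_of_diagonal hD)
  rw [this]
  exact hD

end HermiteBasis

/-! ### Derivatives of power series -/

section PowerSeries

variable {F : Type*} [NormedAddCommGroup F] [NormedSpace ℝ F] [CompleteSpace F]

theorem summable_derivative_of_summable {c : ℕ → F}
    (hc : ∀ r : ℝ, 0 ≤ r → r < 1 → Summable fun n => ‖c n‖ * r ^ n) {r : ℝ} (h0 : 0 ≤ r)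
    (h1 : r < 1) : Summable fun n : ℕ => (n : ℝ) * ‖c n‖ * r ^ (n - 1) := by
  -- Two intermediate radii: convergence at `s` bounds `‖c n‖ sⁿ`, and `t / s < 1` gives the
  -- geometric factor that beats `n`. Since `t > 0`, division is harmless even when `r = 0`.
  obtain ⟨s, hrs, hs1⟩ := exists_between h1
  obtain ⟨t, hrt, hts⟩ := exists_between hrs
  have ht0 : 0 < t := h0.trans_lt hrt
  have hs0 : 0 < s := ht0.trans hts
  obtain ⟨C, hC⟩ := (hc s hs0.le hs1).tendsto_atTop_zero.bddAbove_range
  have hC' (n : ℕ) : ‖c n‖ * s ^ n ≤ C := hC ⟨n, rfl⟩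
  have hq : ‖t / s‖ < 1 := by
    rw [Real.norm_of_nonneg (by positivity), div_lt_one hs0]; exact hts
  refine Summable.of_nonneg_of_le (fun n => by positivity) (fun n => ?_)
    ((summable_pow_mul_geometric_of_norm_lt_one 1 hq).mul_left (C / t))
  rcases n.eq_zero_or_pos with rfl | hn
  · simp
  · calc (n : ℝ) * ‖c n‖ * r ^ (n - 1) ≤ (n : ℝ) * ‖c n‖ * t ^ (n - 1) := by gcongr
      _ = (‖c n‖ * s ^ n) / t * ((n : ℝ) ^ 1 * (t / s) ^ n) := by
          rw [div_pow, ← Nat.sub_add_cancel hn, Nat.add_sub_cancel, pow_succ t]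
          field_simp
      _ ≤ _ := by gcongr; exact hC' n

theorem hasDerivAt_powerSeries {c : ℕ → F}
    (hc : ∀ r : ℝ, 0 ≤ r → r < 1 → Summable fun n => ‖c n‖ * r ^ n) {r : ℝ} (hr : |r| < 1) :
    HasDerivAt (fun z : ℝ => ∑' n : ℕ, z ^ n • c n)
      (∑' n : ℕ, ((n : ℝ) * r ^ (n - 1)) • c n) r := by
  obtain ⟨s, hrs, hs1⟩ := exists_between hr
  have hs0 : 0 ≤ s := (abs_nonneg r).trans hrs.le
  refine hasDerivAt_tsum_of_isPreconnected (g := fun (n : ℕ) (z : ℝ) => z ^ n • c n)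
    (g' := fun (n : ℕ) (z : ℝ) => ((n : ℝ) * z ^ (n - 1)) • c n)
    (u := fun n : ℕ => (n : ℝ) * ‖c n‖ * s ^ (n - 1))
    (t := Metric.ball 0 s) (y₀ := r) (summable_derivative_of_summable hc hs0 hs1)
    Metric.isOpen_ball (convex_ball 0 s).isPreconnected (fun n y _ => ?_) (fun n y hy => ?_)
    (by simpa using hrs) ?_ (by simpa using hrs)
  · exact (hasDerivAt_pow n y).smul_const (c n)
  · have hy' : |y| < s := by simpa using hy
    rw [norm_smul, norm_mul, norm_pow, Real.norm_natCast, Real.norm_eq_abs]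
    calc (n : ℝ) * |y| ^ (n - 1) * ‖c n‖ ≤ (n : ℝ) * s ^ (n - 1) * ‖c n‖ := by gcongr
      _ = _ := by ring
  · refine Summable.of_norm ?_
    refine (hc |r| (abs_nonneg _) hr).congr fun n => ?_
    rw [norm_smul, norm_pow, Real.norm_eq_abs, mul_comm]

end PowerSeries

/-! ### The diagonal of the Mehler kernel -/

section Mehler

open Polynomial

/-- The coefficients `Hₙ(x)² / (2ⁿ n!)`. -/
def mehlerCoeff (x : ℝ) (n : ℕ) : ℝ := (hermitePoly n).eval x ^ 2 / (2 ^ n * n.factorial)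

theorem mehlerCoeff_nonneg (x : ℝ) (n : ℕ) : 0 ≤ mehlerCoeff x n := by
  unfold mehlerCoeff; positivity

theorem eval_hermitePoly_succ_succ (x : ℝ) (n : ℕ) :
    (hermitePoly (n + 2)).eval x
      = 2 * x * (hermitePoly (n + 1)).eval x - 2 * (n + 1) * (hermitePoly n).eval x := by
  rw [hermitePoly_succ_succ]
  simp

theorem eval_hermitePoly_sq (x : ℝ) (n : ℕ) :
    (hermitePoly n).eval x ^ 2 = 2 ^ n * n.factorial * mehlerCoeff x n := by
  unfold mehlerCoeff; field_simp

/-- Squaring the three-term recurrence at index `n + 3` creates a cross term in two consecutive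
Hermite values. The square of the recurrence at `n + 2` eliminates it, leaving a linear relation
among squares. -/
theorem mehlerCoeff_recurrence (x : ℝ) (n : ℕ) :
    (n + 3) * mehlerCoeff x (n + 3) = (2 * x ^ 2 - n - 2) * mehlerCoeff x (n + 2)
      + (n + 2 - 2 * x ^ 2) * mehlerCoeff x (n + 1) + (n + 1) * mehlerCoeff x n := by
  have h2 := eval_hermitePoly_succ_succ x n
  have h3 := eval_hermitePoly_succ_succ x (n + 1)
  have e0 := eval_hermitePoly_sq x n
  have e1 := eval_hermitePoly_sq x (n + 1)
  have e2 := eval_hermitePoly_sq x (n + 2)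
  have e3 := eval_hermitePoly_sq x (n + 3)
  simp only [Nat.factorial_succ, pow_succ] at e0 e1 e2 e3
  push_cast at h3 e0 e1 e2 e3
  have hP : (2 ^ n * n.factorial : ℝ) * (8 * (n + 1) * (n + 2)) ≠ 0 := by positivity
  refine mul_left_cancel₀ hP ?_
  set a := (hermitePoly n).eval x
  set b := (hermitePoly (n + 1)).eval x
  set c := (hermitePoly (n + 2)).eval x
  set d := (hermitePoly (n + 3)).eval x
  have k : d ^ 2 / 2 = (2 * x ^ 2 - n - 2) * c ^ 2 + (n + 2 - 2 * x ^ 2) * (2 * (n + 2)) * b ^ 2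
      + (n + 1) * (4 * (n + 2) * (n + 1)) * a ^ 2 := by
    rw [h3, h2]; ring
  linear_combination 2 * k - e3 + 2 * (2 * x ^ 2 - n - 2) * e2
    + 4 * (n + 2) * (n + 2 - 2 * x ^ 2) * e1 + 8 * (n + 1) * (n + 2) * (n + 1) * e0

theorem mehlerCoeff_zero (x : ℝ) : mehlerCoeff x 0 = 1 := by
  simp [mehlerCoeff, hermitePoly]

theorem mehlerCoeff_one (x : ℝ) : mehlerCoeff x 1 = 2 * x ^ 2 := by
  simp [mehlerCoeff, hermitePoly]; ring

theorem mehlerCoeff_two (x : ℝ) : mehlerCoeff x 2 = (2 * x ^ 2 - 1) ^ 2 / 2 := by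
  simp [mehlerCoeff, hermitePoly, Nat.factorial]; ring

/-- Young's inequality with parameter `δ` on the three-term recurrence. The first factor tends to
zero with `n`, so growth is slower than any geometric rate. -/
theorem mehlerCoeff_succ_succ_le (x : ℝ) (n : ℕ) {δ : ℝ} (hδ : 0 < δ) :
    mehlerCoeff x (n + 2) ≤ (1 + 1 / δ) * (2 * x ^ 2 / (n + 2)) * mehlerCoeff x (n + 1)
      + (1 + δ) * mehlerCoeff x n := by
  have h2 := eval_hermitePoly_succ_succ x n
  set a := (hermitePoly n).eval x with ha
  set b := (hermitePoly (n + 1)).eval x with hb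
  have hsq : (2 * x * b - 2 * (n + 1) * a) ^ 2
      ≤ (1 + 1 / δ) * (2 * x * b) ^ 2 + (1 + δ) * (2 * (n + 1) * a) ^ 2 := by
    have : 0 ≤ (2 * x * b + δ * (2 * (n + 1) * a)) ^ 2 / δ := by positivity
    have e : (2 * x * b + δ * (2 * (n + 1) * a)) ^ 2 / δ
        = 1 / δ * (2 * x * b) ^ 2 + 2 * (2 * x * b) * (2 * (n + 1) * a)
          + δ * (2 * (n + 1) * a) ^ 2 := by
      field_simp
      ring
    nlinarith
  have hm2 : mehlerCoeff x (n + 2) = (2 * x * b - 2 * (n + 1) * a) ^ 2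
      / (2 ^ (n + 2) * (n + 2).factorial) := by rw [mehlerCoeff, h2]
  have hm1 : mehlerCoeff x (n + 1) = b ^ 2 / (2 ^ (n + 1) * (n + 1).factorial) := rfl
  have hm0 : mehlerCoeff x n = a ^ 2 / (2 ^ n * n.factorial) := rfl
  calc mehlerCoeff x (n + 2)
      ≤ ((1 + 1 / δ) * (2 * x * b) ^ 2 + (1 + δ) * (2 * (n + 1) * a) ^ 2)
        / (2 ^ (n + 2) * (n + 2).factorial) := by rw [hm2]; gcongr
    _ = (1 + 1 / δ) * (2 * x ^ 2 / (n + 2)) * mehlerCoeff x (n + 1)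
        + (1 + δ) * ((n + 1) / (n + 2)) * mehlerCoeff x n := by
        rw [hm1, hm0]
        simp only [Nat.factorial_succ, pow_succ]
        push_cast
        field_simp
        ring
    _ ≤ _ := by
        have h0 := mehlerCoeff_nonneg x n
        gcongr
        refine mul_le_of_le_one_right (by positivity) ?_
        rw [div_le_one (by positivity)]
        linarith

theorem summable_mehlerCoeff (x : ℝ) {r : ℝ} (h0 : 0 ≤ r) (h1 : r < 1) :
    Summable fun n => ‖mehlerCoeff x n‖ * r ^ n := by
  obtain ⟨q, hrq, hq1⟩ := exists_between h1
  have hq0 : 0 < q := h0.trans_lt hrq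
  -- Choosing `1 + δ = 1/q` makes the eventual ratio `r/q < 1`.
  obtain ⟨δ, hδ, hδq⟩ : ∃ δ : ℝ, 0 < δ ∧ (1 + δ) * q ≤ 1 := by
    refine ⟨1 / q - 1, ?_, ?_⟩
    · rw [sub_pos, one_lt_div hq0]; exact hq1
    · rw [add_sub_cancel, one_div, inv_mul_cancel₀ hq0.ne']
  have hlim : Tendsto (fun n : ℕ => (1 + 1 / δ) * (2 * x ^ 2 / ((n : ℝ) + 2))) atTop (𝓝 0) := by
    have := ((tendsto_atTop_add_const_right atTop (2 : ℝ)
      tendsto_natCast_atTop_atTop).const_div_atTop (2 * x ^ 2)).const_mul (1 + 1 / δ)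
    simpa using this
  -- Adding neighbours turns the two-step inequality into the one-step bound `S (n + 1) ≤ (1 + δ) S
  -- n`.
  set S : ℕ → ℝ := fun n => mehlerCoeff x n + mehlerCoeff x (n + 1) with hS
  have hSnn (n) : 0 ≤ S n := add_nonneg (mehlerCoeff_nonneg x n) (mehlerCoeff_nonneg x (n + 1))
  have hsum : Summable fun n => S n * r ^ n := by
    refine summable_of_ratio_norm_eventually_le (r := r / q) (by rwa [div_lt_one hq0]) ?_
    filter_upwards [hlim.eventually (gt_mem_nhds hδ)] with n hn
    have e1 : S (n + 1) ≤ (1 + δ) * S n := by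
      have := mehlerCoeff_succ_succ_le x n hδ
      have h4 : (1 + 1 / δ) * (2 * x ^ 2 / ((n : ℝ) + 2)) * mehlerCoeff x (n + 1)
          ≤ δ * mehlerCoeff x (n + 1) :=
        mul_le_mul_of_nonneg_right hn.le (mehlerCoeff_nonneg x (n + 1))
      simp only [hS]
      linarith
    rw [Real.norm_of_nonneg (mul_nonneg (hSnn _) (by positivity)),
      Real.norm_of_nonneg (mul_nonneg (hSnn _) (by positivity)), pow_succ]
    have e2 : 1 + δ ≤ 1 / q := by rwa [le_div_iff₀ hq0]
    calc S (n + 1) * (r ^ n * r) ≤ (1 / q * S n) * (r ^ n * r) := by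
          gcongr
          exact e1.trans (mul_le_mul_of_nonneg_right e2 (hSnn n))
      _ = _ := by ring
  refine Summable.of_nonneg_of_le (fun n => by positivity) (fun n => ?_) hsum
  rw [Real.norm_of_nonneg (mehlerCoeff_nonneg x n)]
  gcongr
  simp only [hS]
  linarith [mehlerCoeff_nonneg x (n + 1)]

/-- The sum of the series `∑ Hₙ(x)² rⁿ / (2ⁿ n!)`. -/
def mehlerSum (x r : ℝ) : ℝ := ∑' n : ℕ, r ^ n • mehlerCoeff x n

theorem hasSum_mehlerSum (x : ℝ) {r : ℝ} (hr : |r| < 1) :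
    HasSum (fun n => mehlerCoeff x n * r ^ n) (mehlerSum x r) := by
  have h1 : Summable fun n : ℕ => r ^ n • mehlerCoeff x n := by
    refine Summable.of_norm ((summable_mehlerCoeff x (abs_nonneg r) hr).congr fun n => ?_)
    rw [norm_smul, norm_pow, Real.norm_eq_abs r, mul_comm]
  simpa [mul_comm, mehlerSum] using h1.hasSum

theorem exists_hasDerivAt_mehlerSum (x : ℝ) {r : ℝ} (hr : |r| < 1) : ∃ M' : ℝ,
    HasDerivAt (mehlerSum x) M' r ∧
      HasSum (fun n : ℕ => (n + 1) * mehlerCoeff x (n + 1) * r ^ n) M' := by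
  refine ⟨_, hasDerivAt_powerSeries (fun s => summable_mehlerCoeff x) hr, ?_⟩
  have h1 : Summable fun n : ℕ => ((n : ℝ) * r ^ (n - 1)) • mehlerCoeff x n := by
    refine Summable.of_norm ((summable_derivative_of_summable
      (fun s => summable_mehlerCoeff x) (abs_nonneg r) hr).congr fun n => ?_)
    rw [norm_smul, norm_mul, norm_pow, Real.norm_eq_abs r, Real.norm_natCast]
    ring
  have h2 := (hasSum_nat_add_iff' 1).2 h1.hasSum
  simp only [Finset.sum_range_one, Nat.cast_zero, zero_mul, zero_smul, sub_zero] at h2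
  refine h2.congr_fun fun n => ?_
  simp only [Nat.add_sub_cancel, smul_eq_mul]
  push_cast
  ring

/-- Generating-function form of the recurrence. It is summed from index one on; the instance at
index zero and the first coefficients account for the initial terms. -/
theorem mehlerSum_ode (x : ℝ) {r M' : ℝ} (hr : |r| < 1)
    (hM : HasSum (fun n : ℕ => (n + 1) * mehlerCoeff x (n + 1) * r ^ n) M') :
    (1 - r ^ 2) * (1 + r) * M' = (r * (1 + r) + 2 * x ^ 2 * (1 - r)) * mehlerSum x r := by
  set d : ℕ → ℝ := fun n => (n + 1) * mehlerCoeff x (n + 1) * r ^ n with hd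
  set m : ℕ → ℝ := fun n => mehlerCoeff x n * r ^ n with hm
  have hS : HasSum m (mehlerSum x r) := hasSum_mehlerSum x hr
  have d3 := (hasSum_nat_add_iff' 3).2 hM
  have d2 := ((hasSum_nat_add_iff' 2).2 hM).mul_left r
  have d1 := ((hasSum_nat_add_iff' 1).2 hM).mul_left (r ^ 2)
  have d0 := hM.mul_left (r ^ 3)
  have m3 := ((hasSum_nat_add_iff' 3).2 hS).mul_left (2 * x ^ 2)
  have m2 := ((hasSum_nat_add_iff' 2).2 hS).mul_left ((1 - 2 * x ^ 2) * r)
  have m1 := ((hasSum_nat_add_iff' 1).2 hS).mul_left (r ^ 2)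
  have hL := ((d3.add d2).sub d1).sub d0
  have hR := (m3.add m2).add m1
  have heq : (fun n => d (n + 3) + r * d (n + 2) - r ^ 2 * d (n + 1) - r ^ 3 * d n)
      = fun n => 2 * x ^ 2 * m (n + 3) + (1 - 2 * x ^ 2) * r * m (n + 2) + r ^ 2 * m (n + 1) := by
    ext n
    have h := mehlerCoeff_recurrence x (n + 1)
    simp only [hd, hm]
    push_cast at h ⊢
    linear_combination r ^ (n + 3) * h
  rw [heq] at hL
  have key := hL.unique hR
  simp only [Finset.sum_range_succ, Finset.sum_range_zero, hd, hm] at key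
  norm_num [mehlerCoeff_zero, mehlerCoeff_one, mehlerCoeff_two] at key
  have hrec := mehlerCoeff_recurrence x 0
  norm_num [mehlerCoeff_zero, mehlerCoeff_one, mehlerCoeff_two] at hrec
  linear_combination key + r ^ 2 * hrec

/-- Mehler's formula on the diagonal. -/
theorem mehlerSum_eq (x : ℝ) {r : ℝ} (h0 : 0 ≤ r) (h1 : r < 1) :
    mehlerSum x r = Real.exp (2 * x ^ 2 * (r / (1 + r))) / √(1 - r ^ 2) := by
  -- `Q` is the series divided by the claimed value. The differential equation makes its derivative
  -- vanish on `[0, 1)`, and `Q 0 = 1`.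
  set Q : ℝ → ℝ := fun z =>
    mehlerSum x z * (√(1 - z ^ 2) * Real.exp (-(2 * x ^ 2 * (z / (1 + z))))) with hQ
  have hder (z : ℝ) (hz0 : 0 ≤ z) (hz1 : z < 1) : HasDerivAt Q 0 z := by
    have hz : |z| < 1 := by rwa [abs_of_nonneg hz0]
    obtain ⟨M', hM, hMs⟩ := exists_hasDerivAt_mehlerSum x hz
    have hode := mehlerSum_ode x hz hMs
    have hp : 0 < 1 - z ^ 2 := by nlinarith
    have hp1 : 0 < 1 + z := by linarith
    have g1 : HasDerivAt (fun z : ℝ => √(1 - z ^ 2)) (-z / √(1 - z ^ 2)) z := by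
      have := ((hasDerivAt_pow 2 z).const_sub 1).sqrt hp.ne'
      refine this.congr_deriv ?_
      field_simp
      norm_num
    have g2 : HasDerivAt (fun z : ℝ => -(2 * x ^ 2 * (z / (1 + z))))
        (-(2 * x ^ 2 * (1 / (1 + z) ^ 2))) z := by
      have := (((hasDerivAt_id z).fun_div ((hasDerivAt_id z).const_add 1)
        hp1.ne').const_mul (2 * x ^ 2)).fun_neg
      refine this.congr_deriv ?_
      simp
    have := hM.mul (g1.mul g2.exp)
    refine this.congr_deriv ?_
    have hs : √(1 - z ^ 2) ^ 2 = 1 - z ^ 2 := Real.sq_sqrt hp.le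
    have hspos : 0 < √(1 - z ^ 2) := Real.sqrt_pos.2 hp
    simp only [Pi.mul_apply]
    set e := Real.exp (-(2 * x ^ 2 * (z / (1 + z))))
    set w := √(1 - z ^ 2)
    have hw : M' * w ^ 2 * (1 + z) ^ 2
        = (z * (1 + z) ^ 2 + 2 * x ^ 2 * w ^ 2) * mehlerSum x z := by
      rw [hs]
      linear_combination (1 + z) * hode
    field_simp
    linear_combination e * hw
  have hconst : Q r = Q 0 := by
    refine constant_of_has_deriv_right_zero (a := 0) (b := r) ?_ ?_ r ⟨h0, le_rfl⟩
    · exact fun z hz => (hder z hz.1 (hz.2.trans_lt h1)).continuousAt.continuousWithinAt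
    · exact fun z hz => (hder z hz.1 (hz.2.trans h1)).hasDerivWithinAt
  have hQ0 : Q 0 = 1 := by
    have h2 := (hasSum_mehlerSum x (r := 0) (by simp)).unique
      (hasSum_single 0 fun n hn => by simp [hn])
    simp only [pow_zero, mul_one, mehlerCoeff_zero] at h2
    simp [hQ, h2]
  rw [hQ0] at hconst
  have hp : 0 < √(1 - r ^ 2) := Real.sqrt_pos.2 (by nlinarith)
  simp only [hQ, Real.exp_neg] at hconst
  rw [eq_div_iff hp.ne']
  rwa [← mul_assoc, mul_inv_eq_one₀ (Real.exp_ne_zero _)] at hconst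

/-! ### Hermite densities and the diagonal of multiplication operators -/

theorem hermiteFun_apply (n : ℕ) (x : ℝ) :
    hermiteFun n x =
      (((hermitePoly n).eval x / hermiteNorm n * Real.exp (-x ^ 2 / 2) : ℝ) : ℂ) := by
  rw [hermiteFun, polyGauss_apply, polyGaussFun, eval_smul, smul_eq_mul, inv_mul_eq_div]

/-- The square of the `n`-th Hermite function. -/
def hermiteDensity (n : ℕ) (x : ℝ) : ℝ := mehlerCoeff x n * Real.exp (-x ^ 2) / √Real.pi

theorem hermiteDensity_nonneg (n : ℕ) (x : ℝ) : 0 ≤ hermiteDensity n x := by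
  have := mehlerCoeff_nonneg x n
  unfold hermiteDensity; positivity

theorem hermiteFun_mul_self (n : ℕ) (x : ℝ) :
    hermiteFun n x * hermiteFun n x = (hermiteDensity n x : ℂ) := by
  rw [hermiteFun_apply, ← Complex.ofReal_mul, hermiteDensity, mehlerCoeff]
  congr 1
  have h1 := hermiteNorm_sq n
  have h2 : Real.exp (-x ^ 2) = Real.exp (-x ^ 2 / 2) ^ 2 := by
    rw [← Real.exp_nat_mul]; congr 1; push_cast; ring
  have h3 := (hermiteNorm_pos n).ne'
  rw [h2, div_mul_eq_mul_div, div_mul_div_comm, ← sq (hermiteNorm n), h1]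
  field_simp

theorem integrable_hermiteDensity (n : ℕ) : Integrable (hermiteDensity n) := by
  have h := (integrable_schwartz_mul (hermiteFun n) (hermiteFun n)).re
  refine h.congr (Eventually.of_forall fun x => ?_)
  simp only
  rw [hermiteFun_mul_self]
  simp

theorem integral_hermiteDensity (n : ℕ) : ∫ x, hermiteDensity n x = 1 := by
  have h := orthonormal_iff_ite.1 orthonormal_hermiteFun n n
  rw [if_pos rfl] at h
  have h2 := inner_polyGauss_schwartz ((hermiteNorm n)⁻¹ • hermitePoly n) (hermiteFun n)
  change inner ℂ (schwartzToL2 (hermiteFun n)) (schwartzToL2 (hermiteFun n))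
    = ∫ x, hermiteFun n x * hermiteFun n x at h2
  rw [h] at h2
  simp_rw [hermiteFun_mul_self] at h2
  rw [integral_complex_ofReal] at h2
  exact_mod_cast h2.symm

/-- With the weight `exp(-x²)` Mehler's exponent becomes `-(1 - r)/(1 + r) x²`, a Gaussian that
flattens as `r → 1`. -/
theorem hasSum_hermiteDensity (x : ℝ) {r : ℝ} (h0 : 0 ≤ r) (h1 : r < 1) :
    HasSum (fun n => r ^ n * hermiteDensity n x)
      (Real.exp (-((1 - r) / (1 + r)) * x ^ 2) / (√Real.pi * √(1 - r ^ 2))) := by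
  have h := (hasSum_mehlerSum x (r := r) (by rwa [abs_of_nonneg h0])).mul_right
    (Real.exp (-x ^ 2) / √Real.pi)
  rw [mehlerSum_eq x h0 h1, div_mul_div_comm, ← Real.exp_add, mul_comm (√(1 - r ^ 2))] at h
  have e : -((1 - r) / (1 + r)) * x ^ 2 = 2 * x ^ 2 * (r / (1 + r)) + -x ^ 2 := by
    field_simp
    ring
  rw [e]
  exact h.congr_fun fun n => by rw [hermiteDensity]; ring

/-- The diagonal entries of a multiplication operator in the Hermite basis. -/
theorem inner_hermiteBasis_mulOp (f : ℝ →ᵇ ℂ) (n : ℕ) :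
    inner ℂ (hermiteBasis n) (mulOp f (hermiteBasis n)) = ∫ x, (hermiteDensity n x : ℂ) * f x := by
  rw [hermiteBasis_apply]
  have h := inner_polyGauss ((hermiteNorm n)⁻¹ • hermitePoly n)
    (mulOp f (schwartzToL2 (hermiteFun n)))
  rw [← hermiteFun] at h
  rw [h]
  refine integral_congr_ae ?_
  filter_upwards [mulOp_apply_ae f (schwartzToL2 (hermiteFun n)),
    coeFn_schwartzToL2 (hermiteFun n)] with x h1 h2
  rw [h1, h2, ← hermiteFun_mul_self]
  ring

theorem norm_hermiteDensity_mul_le (f : ℝ →ᵇ ℂ) (n : ℕ) (x : ℝ) :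
    ‖(hermiteDensity n x : ℂ) * f x‖ ≤ ‖f‖ * hermiteDensity n x := by
  rw [norm_mul, Complex.norm_real, Real.norm_of_nonneg (hermiteDensity_nonneg n x), mul_comm]
  exact mul_le_mul_of_nonneg_right (f.norm_coe_le_norm x) (hermiteDensity_nonneg n x)

theorem integrable_hermiteDensity_mul (f : ℝ →ᵇ ℂ) (n : ℕ) :
    Integrable fun x => (hermiteDensity n x : ℂ) * f x :=
  ((integrable_hermiteDensity n).const_mul ‖f‖).mono'
    ((Complex.continuous_ofReal.comp_aestronglyMeasurable
      (integrable_hermiteDensity n).1).mul f.continuous.aestronglyMeasurable)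
    (Eventually.of_forall (norm_hermiteDensity_mul_le f n))

theorem norm_inner_hermiteBasis_mulOp_le (f : ℝ →ᵇ ℂ) (n : ℕ) :
    ‖inner ℂ (hermiteBasis n) (mulOp f (hermiteBasis n))‖ ≤ ‖f‖ := by
  rw [inner_hermiteBasis_mulOp]
  refine (norm_integral_le_of_norm_le ((integrable_hermiteDensity n).const_mul ‖f‖)
    (Eventually.of_forall (norm_hermiteDensity_mul_le f n))).trans ?_
  rw [integral_const_mul, integral_hermiteDensity, mul_one]

/-- The generating function of the diagonal entries of a multiplication operator is a Gaussian
average. -/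
theorem hasSum_inner_hermiteBasis_mulOp (f : ℝ →ᵇ ℂ) {r : ℝ} (h0 : 0 ≤ r) (h1 : r < 1) :
    HasSum (fun n => r ^ n • inner ℂ (hermiteBasis n) (mulOp f (hermiteBasis n)))
      ((1 / (√Real.pi * √(1 - r ^ 2)) : ℝ) •
        ∫ x, Real.exp (-((1 - r) / (1 + r)) * x ^ 2) • f x) := by
  -- Sum and integral may be exchanged because each density has mass one, so the norms integrate to
  -- at most `‖f‖ rⁿ`.
  have hF := hasSum_integral_of_summable_integral_norm (μ := volume)
    (F := fun (n : ℕ) (x : ℝ) => r ^ n • ((hermiteDensity n x : ℂ) * f x))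
    (fun n => (integrable_hermiteDensity_mul f n).smul (r ^ n)) ?_
  · have e : (1 / (√Real.pi * √(1 - r ^ 2)) : ℝ) •
        ∫ x, Real.exp (-((1 - r) / (1 + r)) * x ^ 2) • f x
        = ∫ x, ∑' n : ℕ, r ^ n • ((hermiteDensity n x : ℂ) * f x) := by
      rw [← integral_smul]
      congr 1
      ext x
      have h2 : HasSum (fun n => r ^ n • ((hermiteDensity n x : ℂ) * f x)) _ :=
        ((hasSum_hermiteDensity x h0 h1).smul_const (f x)).congr_fun fun n => by
          simp only [Complex.real_smul]; push_cast; ring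
      rw [h2.tsum_eq, smul_smul]
      congr 1
      ring
    rw [e]
    exact hF.congr_fun fun n => by rw [integral_smul, inner_hermiteBasis_mulOp]
  · refine Summable.of_nonneg_of_le (fun n => integral_nonneg fun x => norm_nonneg _)
      (fun n => ?_) ((summable_geometric_of_lt_one h0 h1).mul_left ‖f‖)
    have h3 : ∫ x, ‖f‖ * r ^ n * hermiteDensity n x = ‖f‖ * r ^ n := by
      rw [integral_const_mul, integral_hermiteDensity, mul_one]
    rw [← h3]
    refine integral_mono_of_nonneg (Eventually.of_forall fun x => norm_nonneg _)
      ((integrable_hermiteDensity n).const_mul _) (Eventually.of_forall fun x => ?_)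
    simp only
    rw [norm_smul, norm_pow, Real.norm_of_nonneg h0]
    have := norm_hermiteDensity_mul_le f n x
    calc r ^ n * ‖(hermiteDensity n x : ℂ) * f x‖ ≤ r ^ n * (‖f‖ * hermiteDensity n x) := by
          gcongr
      _ = _ := by ring

end Mehler

/-! ### Gaussian averages -/

section GaussianMean

theorem integrable_sq_mul_exp_neg_sq : Integrable fun y : ℝ => 2 * y ^ 2 * Real.exp (-y ^ 2) := by
  have h := (integrable_rpow_mul_exp_neg_mul_sq (b := 1) one_pos (s := 2) (by norm_num)).const_mul 2
  refine h.congr (Eventually.of_forall fun y => ?_)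
  simp only [Real.rpow_two, neg_mul, one_mul]
  ring

theorem integrable_exp_neg_sq : Integrable fun y : ℝ => Real.exp (-y ^ 2) := by
  simpa using integrable_exp_neg_mul_sq (b := 1) one_pos

/-- Integration by parts on the line; linear growth of `v` suffices against the Gaussian. -/
theorem integral_exp_neg_sq_smul {v v' : ℝ → ℂ} (hv : ∀ y, HasDerivAt v (v' y) y)
    (hv' : Continuous v') {C : ℝ} (hC' : ∀ y, ‖v' y‖ ≤ C) (hC : ∀ y, ‖v y‖ ≤ C * |y|) :
    ∫ y : ℝ, Real.exp (-y ^ 2) • v' y = ∫ y : ℝ, (2 * y * Real.exp (-y ^ 2)) • v y := by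
  have hvc : Continuous v := continuous_iff_continuousAt.2 fun y => (hv y).continuousAt
  have hC0 : 0 ≤ C := (norm_nonneg _).trans (hC' 0)
  have hu (y : ℝ) : HasDerivAt (fun y : ℝ => ((Real.exp (-y ^ 2) : ℝ) : ℂ))
      ((-(2 * y * Real.exp (-y ^ 2)) : ℝ) : ℂ) y := by
    have h2 : HasDerivAt (fun y : ℝ => -y ^ 2) (-(2 * y)) y := by
      refine (hasDerivAt_pow 2 y).fun_neg.congr_deriv ?_
      norm_num
    have h3 := h2.exp.ofReal_comp
    refine h3.congr_deriv ?_
    congr 1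
    ring
  have i1 : Integrable fun y : ℝ => ((Real.exp (-y ^ 2) : ℝ) : ℂ) * v' y := by
    refine (integrable_exp_neg_sq.const_mul C).mono'
      (Continuous.aestronglyMeasurable (by fun_prop)) (Eventually.of_forall fun y => ?_)
    rw [norm_mul, Complex.norm_real, Real.norm_of_nonneg (Real.exp_pos _).le, mul_comm]
    gcongr
    exact hC' y
  have i2 : Integrable fun y : ℝ => ((-(2 * y * Real.exp (-y ^ 2)) : ℝ) : ℂ) * v y := by
    refine (integrable_sq_mul_exp_neg_sq.const_mul C).mono'
      (Continuous.aestronglyMeasurable (by fun_prop)) (Eventually.of_forall fun y => ?_)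
    rw [norm_mul, Complex.norm_real, norm_neg, norm_mul, norm_mul,
      Real.norm_of_nonneg (Real.exp_pos _).le, Real.norm_eq_abs, Real.norm_eq_abs, abs_two]
    calc 2 * |y| * Real.exp (-y ^ 2) * ‖v y‖ ≤ 2 * |y| * Real.exp (-y ^ 2) * (C * |y|) := by
          gcongr; exact hC y
      _ = C * (2 * |y| ^ 2 * Real.exp (-y ^ 2)) := by ring
      _ = _ := by rw [sq_abs]
  have i3 : Integrable fun y : ℝ => ((Real.exp (-y ^ 2) : ℝ) : ℂ) * v y := by
    refine ((integrable_exp_neg_sq.add integrable_sq_mul_exp_neg_sq).const_mul C).mono'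
      (Continuous.aestronglyMeasurable (by fun_prop)) (Eventually.of_forall fun y => ?_)
    rw [norm_mul, Complex.norm_real, Real.norm_of_nonneg (Real.exp_pos _).le]
    simp only [Pi.add_apply]
    calc Real.exp (-y ^ 2) * ‖v y‖ ≤ Real.exp (-y ^ 2) * (C * (1 + 2 * y ^ 2)) := by
          gcongr
          refine (hC y).trans ?_
          gcongr
          nlinarith [sq_nonneg (|y| - 1), sq_abs y]
      _ = _ := by ring
  have key := integral_mul_deriv_eq_deriv_mul_of_integrable (u := fun y : ℝ =>
    ((Real.exp (-y ^ 2) : ℝ) : ℂ)) (v := v) (fun y _ => hu y) (fun y _ => hv y) i1 i2 i3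
  simp only [Complex.real_smul]
  rw [key, ← integral_neg]
  congr 1
  ext y
  push_cast
  ring

theorem integral_sq_mul_exp_neg_sq : ∫ y : ℝ, 2 * y ^ 2 * Real.exp (-y ^ 2) = √Real.pi := by
  have h := integral_exp_neg_sq_smul (v := fun y : ℝ => (y : ℂ)) (v' := fun _ => 1) (C := 1)
    (fun y => (hasDerivAt_id y).ofReal_comp) continuous_const (fun y => by simp)
    (fun y => by simp)
  have h1 : ∫ y : ℝ, Real.exp (-y ^ 2) = √Real.pi := by
    simpa using integral_gaussian 1
  have e1 : ∀ y : ℝ, Real.exp (-y ^ 2) • (1 : ℂ) = ((Real.exp (-y ^ 2) : ℝ) : ℂ) := fun y => by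
    rw [Complex.real_smul, mul_one]
  have e2 : ∀ y : ℝ, (2 * y * Real.exp (-y ^ 2)) • (y : ℂ)
      = ((2 * y ^ 2 * Real.exp (-y ^ 2) : ℝ) : ℂ) := fun y => by
    rw [Complex.real_smul]; push_cast; ring
  simp_rw [e1, e2] at h
  rw [integral_complex_ofReal, integral_complex_ofReal, h1] at h
  exact_mod_cast h.symm

/-- The even weight puts half of its mass on each half-line; this is the origin of the average of
`μ₋` and `μ₊`. -/
theorem integral_sq_mul_exp_neg_sq_smul_ite (μp μm : ℂ) :
    ∫ y : ℝ, (2 * y ^ 2 * Real.exp (-y ^ 2)) • (if 0 < y then μp else μm)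
      = √Real.pi • ((1 / 2) * μm + (1 / 2) * μp) := by
  set h : ℝ → ℂ := fun y => (2 * y ^ 2 * Real.exp (-y ^ 2)) • (if 0 < y then μp else μm) with hh
  have hi : Integrable h := by
    refine (integrable_sq_mul_exp_neg_sq.const_mul (‖μp‖ + ‖μm‖)).mono' ?_
      (Eventually.of_forall fun y => ?_)
    · have hc : Continuous fun y : ℝ => 2 * y ^ 2 * Real.exp (-y ^ 2) := by fun_prop
      refine hc.aestronglyMeasurable.smul ?_
      exact (StronglyMeasurable.ite measurableSet_Ioi stronglyMeasurable_const
        stronglyMeasurable_const).aestronglyMeasurable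
    · rw [hh, norm_smul, Real.norm_of_nonneg (by positivity), mul_comm]
      gcongr
      split_ifs
      · linarith [norm_nonneg μm]
      · linarith [norm_nonneg μp]
  have h1 : ∫ y, h (-y) = ∫ y, h y := integral_neg_eq_self h volume
  have h2 : ∫ y, (h y + h (-y)) = √Real.pi • (μm + μp) := by
    rw [← integral_sq_mul_exp_neg_sq, ← integral_smul_const]
    refine integral_congr_ae ?_
    filter_upwards [Measure.ae_ne volume (0 : ℝ)] with y hy
    simp only [hh, neg_sq, ← smul_add]
    congr 1
    rcases lt_or_gt_of_ne hy with h | h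
    · rw [if_neg (not_lt.2 h.le), if_pos (neg_pos.2 h)]
    · rw [if_pos h, if_neg (by linarith), add_comm]
  rw [integral_add hi hi.comp_neg, h1] at h2
  have h3 : ∫ y, h y = (1 / 2 : ℂ) * (√Real.pi • (μm + μp)) := by rw [← h2]; ring
  rw [h3]
  simp only [Complex.real_smul]
  ring

/-- The averages of a function with asymptotic mean `m` against dilated Gaussians tend to `m`. -/
theorem tendsto_integral_exp_neg_sq_smul_comp_mul (f : ℝ →ᵇ ℂ) {m : ℂ}
    (hm : HasAsymptoticMean f m) :
    Tendsto (fun t : ℝ => ∫ y : ℝ, Real.exp (-y ^ 2) • f (t * y)) atTop (𝓝 (√Real.pi • m)) := by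
  obtain ⟨μm, μp, hbot, htop, rfl⟩ := hm
  rw [← integral_sq_mul_exp_neg_sq_smul_ite]
  set P : ℝ → ℂ := fun x => ∫ u in (0 : ℝ)..x, f u with hP
  have hPd (x : ℝ) : HasDerivAt P (f x) x :=
    intervalIntegral.integral_hasDerivAt_right (f.continuous.intervalIntegrable _ _)
      (f.continuous.stronglyMeasurableAtFilter _ _) f.continuous.continuousAt
  have hPb (x : ℝ) : ‖P x‖ ≤ ‖f‖ * |x| := by
    have := intervalIntegral.norm_integral_le_of_norm_le_const (a := 0) (b := x) (C := ‖f‖)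
      (f := f) fun u _ => f.norm_coe_le_norm u
    simpa using this
  have hPc : Continuous P := continuous_iff_continuousAt.2 fun y => (hPd y).continuousAt
  -- The values `f (t y)` need not converge as `t → ∞`, but `t⁻¹ P (t y)` tends to `y μ₊` or `y μ₋`;
  -- integration by parts trades one for the other.
  have hbp : ∀ᶠ t : ℝ in atTop, ∫ y : ℝ, (2 * y * Real.exp (-y ^ 2)) • (t⁻¹ • P (t * y))
      = ∫ y : ℝ, Real.exp (-y ^ 2) • f (t * y) := by
    filter_upwards [eventually_gt_atTop 0] with t ht
    refine (integral_exp_neg_sq_smul (C := ‖f‖) (fun y => ?_) (by fun_prop)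
      (fun y => f.norm_coe_le_norm _) (fun y => ?_)).symm
    · have h1 : HasDerivAt (fun y : ℝ => t * y) t y := by
        simpa using (hasDerivAt_id y).const_mul t
      refine (((hPd (t * y)).scomp y h1).const_smul t⁻¹).congr_deriv ?_
      rw [smul_smul, inv_mul_cancel₀ ht.ne', one_smul]
    · rw [norm_smul, norm_inv, Real.norm_of_nonneg ht.le]
      calc t⁻¹ * ‖P (t * y)‖ ≤ t⁻¹ * (‖f‖ * |t * y|) := by gcongr; exact hPb _
        _ = ‖f‖ * |y| := by rw [abs_mul, abs_of_pos ht]; field_simp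
  refine Tendsto.congr' hbp ?_
  refine tendsto_integral_filter_of_dominated_convergence
    (fun y => ‖f‖ * (2 * y ^ 2 * Real.exp (-y ^ 2)))
    (Eventually.of_forall fun t => Continuous.aestronglyMeasurable (by fun_prop)) ?_
    (integrable_sq_mul_exp_neg_sq.const_mul _) (Eventually.of_forall fun y => ?_)
  · filter_upwards [eventually_gt_atTop 0] with t ht
    refine Eventually.of_forall fun y => ?_
    rw [norm_smul, norm_smul, norm_inv, Real.norm_of_nonneg ht.le, norm_mul, norm_mul,
      Real.norm_of_nonneg (Real.exp_pos _).le, Real.norm_eq_abs, Real.norm_eq_abs, abs_two]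
    calc 2 * |y| * Real.exp (-y ^ 2) * (t⁻¹ * ‖P (t * y)‖)
        ≤ 2 * |y| * Real.exp (-y ^ 2) * (t⁻¹ * (‖f‖ * |t * y|)) := by gcongr; exact hPb _
      _ = ‖f‖ * (2 * |y| ^ 2 * Real.exp (-y ^ 2)) := by
          rw [abs_mul, abs_of_pos ht]; field_simp
      _ = _ := by rw [sq_abs]
  · have hlim (c : ℂ) (hc : Tendsto (fun t : ℝ => (1 / ((t * y : ℝ) : ℂ)) * P (t * y)) atTop (𝓝 c))
        (hy : y ≠ 0) : Tendsto (fun t : ℝ => (2 * y * Real.exp (-y ^ 2)) • (t⁻¹ • P (t * y))) atTop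
          (𝓝 ((2 * y ^ 2 * Real.exp (-y ^ 2)) • c)) := by
      refine (hc.const_smul (2 * y ^ 2 * Real.exp (-y ^ 2))).congr' ?_
      filter_upwards [eventually_gt_atTop 0] with t ht
      simp only [Complex.real_smul]
      have h1 : (y : ℂ) ≠ 0 := by exact_mod_cast hy
      have h2 : (t : ℂ) ≠ 0 := by exact_mod_cast ht.ne'
      push_cast
      field_simp
    rcases lt_trichotomy y 0 with hy | hy | hy
    · rw [if_neg (not_lt.2 hy.le)]
      exact hlim μm (hbot.comp (tendsto_id.atTop_mul_const_of_neg hy)) hy.ne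
    · simp [hy]
    · rw [if_pos hy]
      exact hlim μp (htop.comp (tendsto_id.atTop_mul_const hy)) hy.ne'

theorem tendsto_gaussian_mean (f : ℝ →ᵇ ℂ) {m : ℂ} (hm : HasAsymptoticMean f m) :
    Tendsto (fun s : ℝ => √s • ∫ x : ℝ, Real.exp (-s * x ^ 2) • f x) (𝓝[>] 0)
      (𝓝 (√Real.pi • m)) := by
  have hs : Tendsto (fun s : ℝ => (√s)⁻¹) (𝓝[>] 0) atTop := by
    refine tendsto_inv_nhdsGT_zero.comp ?_
    refine tendsto_nhdsWithin_iff.2 ⟨?_, ?_⟩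
    · have := (Real.continuous_sqrt.tendsto 0).mono_left (nhdsWithin_le_nhds (s := Set.Ioi 0))
      simpa using this
    · filter_upwards [self_mem_nhdsWithin] with s hs
      exact Real.sqrt_pos.2 hs
  refine ((tendsto_integral_exp_neg_sq_smul_comp_mul f hm).comp hs).congr' ?_
  filter_upwards [self_mem_nhdsWithin] with s hs
  have hs0 : 0 < s := hs
  have hsq : 0 < √s := Real.sqrt_pos.2 hs0
  have h := Measure.integral_comp_mul_left (fun x : ℝ => Real.exp (-s * x ^ 2) • f x) (√s)⁻¹
  rw [inv_inv, abs_of_pos hsq] at h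
  rw [← h]
  simp only [Function.comp_apply]
  congr 1
  ext y
  congr 2
  rw [mul_pow, inv_pow, Real.sq_sqrt hs0.le]
  field_simp

end GaussianMean

/-! ### From Abel means to logarithmic means -/

section LogMean

/-- Coefficients of the primitive of a power series. -/
def primitiveCoeff (b : ℕ → ℂ) : ℕ → ℂ
  | 0 => 0
  | n + 1 => b n / (n + 1)

variable {b : ℕ → ℂ} {C : ℝ}

theorem norm_primitiveCoeff_succ_le (hb : ∀ n, ‖b n‖ ≤ C) (n : ℕ) :
    ‖primitiveCoeff b (n + 1)‖ ≤ C / (n + 1) := by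
  have h : ‖(n + 1 : ℂ)‖ = n + 1 := by
    rw [← Nat.cast_succ, Complex.norm_natCast]; push_cast; rfl
  rw [primitiveCoeff, norm_div, h]
  gcongr
  exact hb n

theorem summable_primitiveCoeff (hb : ∀ n, ‖b n‖ ≤ C) {r : ℝ} (h0 : 0 ≤ r) (h1 : r < 1) :
    Summable fun n => ‖primitiveCoeff b n‖ * r ^ n := by
  have hC : 0 ≤ C := (norm_nonneg _).trans (hb 0)
  refine Summable.of_nonneg_of_le (fun n => by positivity) (fun n => ?_)
    ((summable_geometric_of_lt_one h0 h1).mul_left C)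
  gcongr
  cases n with
  | zero => simpa [primitiveCoeff] using hC
  | succ n =>
    refine (norm_primitiveCoeff_succ_le hb n).trans (div_le_self hC ?_)
    have : (0 : ℝ) ≤ n := by positivity
    linarith

theorem hasDerivAt_primitive (hb : ∀ n, ‖b n‖ ≤ C) {r : ℝ} (h0 : 0 ≤ r) (h1 : r < 1) :
    HasDerivAt (fun z : ℝ => ∑' n : ℕ, z ^ n • primitiveCoeff b n) (∑' n : ℕ, r ^ n • b n) r := by
  refine (hasDerivAt_powerSeries (fun s => summable_primitiveCoeff hb)
    (by rwa [abs_of_nonneg h0])).congr_deriv ?_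
  have hs : Summable fun n : ℕ => ((n : ℝ) * r ^ (n - 1)) • primitiveCoeff b n := by
    refine Summable.of_norm ((summable_derivative_of_summable
      (fun s => summable_primitiveCoeff hb) h0 h1).congr fun n => ?_)
    rw [norm_smul, norm_mul, norm_pow, Real.norm_of_nonneg h0, Real.norm_natCast]
    ring
  rw [hs.tsum_eq_zero_add]
  simp only [Nat.cast_zero, zero_mul, zero_smul, zero_add, Nat.add_sub_cancel]
  refine tsum_congr fun n => ?_
  simp only [primitiveCoeff, Complex.real_smul]
  have : (n + 1 : ℂ) ≠ 0 := by exact_mod_cast n.succ_ne_zero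
  push_cast
  field_simp

/-- At `r = 1 - 1/(n + 2)` Bernoulli's inequality bounds each of the `n + 1` head differences by `C
(1 - r)`. The tail coefficients are at most `C / (n + 2)` and the geometric series contributes `n +
2`. Each part is at most `C`. -/
theorem norm_sum_sub_primitive_le (hb : ∀ n, ‖b n‖ ≤ C) (n : ℕ) :
    ‖∑ k ∈ Finset.range (n + 1), b k / (k + 1)
      - ∑' j : ℕ, (1 - 1 / ((n : ℝ) + 2)) ^ j • primitiveCoeff b j‖ ≤ 2 * C := by
  have hC : 0 ≤ C := (norm_nonneg _).trans (hb 0)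
  set r : ℝ := 1 - 1 / ((n : ℝ) + 2) with hr
  have hn : (0 : ℝ) < n + 2 := by positivity
  have hinv : 1 / ((n : ℝ) + 2) ≤ 1 := by
    rw [div_le_one hn]
    have : (0 : ℝ) ≤ n := by positivity
    linarith
  have h0 : 0 ≤ r := by rw [hr]; linarith
  have h1 : r < 1 := by
    rw [hr]
    have : 0 < 1 / ((n : ℝ) + 2) := by positivity
    linarith
  have h1r : 1 - r = 1 / ((n : ℝ) + 2) := by rw [hr]; ring
  set g : ℕ → ℂ := fun j => r ^ j • primitiveCoeff b j with hg
  have hgn : Summable fun j => ‖g j‖ :=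
    (summable_primitiveCoeff hb h0 h1).congr fun j => by
      rw [hg, norm_smul, norm_pow, Real.norm_of_nonneg h0, mul_comm]
  have hsplit := hgn.of_norm.sum_add_tsum_nat_add (n + 2)
  rw [← hsplit, Finset.sum_range_succ' g]
  have hg0 : g 0 = 0 := by simp [hg, primitiveCoeff]
  rw [hg0, add_zero, ← sub_sub, ← Finset.sum_sub_distrib]
  have hA : ‖∑ k ∈ Finset.range (n + 1), (b k / (k + 1) - g (k + 1))‖ ≤ C := by
    refine (norm_sum_le_of_le (f := fun k => b k / (k + 1) - g (k + 1))
      (n := fun _ => C * (1 / ((n : ℝ) + 2))) _ fun k _ => ?_).trans ?_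
    · have e : b k / (k + 1) - g (k + 1) = (1 - r ^ (k + 1) : ℝ) • primitiveCoeff b (k + 1) := by
        simp only [hg, primitiveCoeff, sub_smul, one_smul]
      have hp : r ^ (k + 1) ≤ 1 := pow_le_one₀ h0 h1.le
      have hbern : 1 - (k + 1) * (1 - r) ≤ r ^ (k + 1) := by
        have := one_add_mul_le_pow (a := r - 1) (by linarith) (k + 1)
        push_cast at this
        rw [add_sub_cancel] at this
        linarith
      rw [e, norm_smul, Real.norm_of_nonneg (by linarith), ← h1r]
      calc (1 - r ^ (k + 1)) * ‖primitiveCoeff b (k + 1)‖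
          ≤ ((k + 1) * (1 - r)) * (C / (k + 1)) :=
            mul_le_mul (by linarith) (norm_primitiveCoeff_succ_le hb k) (norm_nonneg _)
              (mul_nonneg (by positivity) (by linarith))
        _ = C * (1 - r) := by field_simp
    · rw [Finset.sum_const, Finset.card_range, nsmul_eq_mul]
      push_cast
      rw [mul_left_comm]
      refine mul_le_of_le_one_right hC ?_
      rw [mul_one_div, div_le_one hn]
      linarith
  have hB : ‖∑' j, g (j + (n + 2))‖ ≤ C := by
    have hgeo : HasSum (fun j : ℕ => C / ((n : ℝ) + 2) * r ^ j)
        (C / ((n : ℝ) + 2) * (1 - r)⁻¹) := (hasSum_geometric_of_lt_one h0 h1).mul_left _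
    have hle (j : ℕ) : ‖g (j + (n + 2))‖ ≤ C / ((n : ℝ) + 2) * r ^ j := by
      rw [hg, norm_smul, norm_pow, Real.norm_of_nonneg h0, mul_comm]
      have e1 : ‖primitiveCoeff b (j + (n + 2))‖ ≤ C / ((n : ℝ) + 2) := by
        refine (norm_primitiveCoeff_succ_le hb (j + (n + 1))).trans ?_
        refine div_le_div_of_nonneg_left hC hn ?_
        push_cast
        have : (0 : ℝ) ≤ j := by positivity
        linarith
      exact mul_le_mul e1 (pow_le_pow_of_le_one h0 h1.le (by omega)) (by positivity)
        (by positivity)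
    refine (tsum_of_norm_bounded hgeo hle).trans (le_of_eq ?_)
    rw [h1r]
    field_simp
  refine (norm_sub_le _ _).trans ?_
  linarith

/-- A bounded sequence whose Abel means tend to zero has vanishing logarithmic means. -/
theorem tendsto_logMean_zero_of_abel (hb : ∀ n, ‖b n‖ ≤ C)
    (h : Tendsto (fun r : ℝ => (1 - r) • ∑' n : ℕ, r ^ n • b n) (𝓝[<] 1) (𝓝 0)) :
    Tendsto (fun n : ℕ => (∑ k ∈ Finset.range (n + 1), b k / (k + 1)) /
      (Real.log (n + 2) : ℂ)) atTop (𝓝 0) := by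
  rw [NormedAddGroup.tendsto_nhds_zero]
  intro ε hε
  set G : ℝ → ℂ := fun r => ∑' n : ℕ, r ^ n • b n with hG
  set B : ℝ → ℂ := fun z => ∑' n : ℕ, z ^ n • primitiveCoeff b n with hB
  have hev : ∀ᶠ r : ℝ in 𝓝[<] 1, ‖(1 - r) • G r‖ < ε / 2 :=
    (NormedAddGroup.tendsto_nhds_zero.1 h) _ (by positivity)
  obtain ⟨l, hl1, hl⟩ := (mem_nhdsLT_iff_exists_Ioo_subset).1 hev
  obtain ⟨a, hal, ha1⟩ := exists_between (max_lt (show l < 1 from hl1) zero_lt_one)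
  have ha0 : 0 < a := (le_max_right _ _).trans_lt hal
  have hla : l < a := (le_max_left _ _).trans_lt hal
  -- The derivative of the primitive `B` is `G`, of norm at most `(ε/2) / (1 - r)` beyond `a`;
  -- integration gives logarithmic growth with constant `ε/2`.
  have hgrow (r : ℝ) (har : a ≤ r) (hr1 : r < 1) :
      ‖B r‖ ≤ ‖B a‖ + ε / 2 * (Real.log (1 - a) - Real.log (1 - r)) := by
    have hder (x : ℝ) (hx : x ∈ Set.Icc a r) : HasDerivAt B (G x) x :=
      hasDerivAt_primitive hb (ha0.le.trans hx.1) (hx.2.trans_lt hr1)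
    have hlog (x : ℝ) (hx : x ∈ Set.Icc a r) : HasDerivAt
        (fun x => ‖B a‖ + ε / 2 * (Real.log (1 - a) - Real.log (1 - x)))
        (ε / 2 * (1 / (1 - x))) x := by
      have hx1 : 1 - x ≠ 0 := by have := hx.2; linarith
      have h1 := ((((hasDerivAt_id x).const_sub 1).log hx1).const_sub
        (Real.log (1 - a))).const_mul (ε / 2)
      refine (h1.const_add ‖B a‖).congr_deriv ?_
      simp only [id]
      ring
    refine image_norm_le_of_norm_deriv_right_le_deriv_boundary' (f := B) (f' := G)
      (B := fun x => ‖B a‖ + ε / 2 * (Real.log (1 - a) - Real.log (1 - x)))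
      (B' := fun x => ε / 2 * (1 / (1 - x)))
      (fun x hx => (hder x hx).continuousAt.continuousWithinAt)
      (fun x hx => (hder x (Set.Ico_subset_Icc_self hx)).hasDerivWithinAt) (by simp)
      (fun x hx => (hlog x hx).continuousAt.continuousWithinAt)
      (fun x hx => (hlog x (Set.Ico_subset_Icc_self hx)).hasDerivWithinAt)
      (fun x hx => ?_) ⟨har, le_rfl⟩
    have hx1 : x < 1 := hx.2.trans hr1
    have h2 : ‖(1 - x) • G x‖ < ε / 2 := hl ⟨hla.trans_le hx.1, hx1⟩
    rw [norm_smul, Real.norm_of_nonneg (by linarith)] at h2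
    rw [mul_one_div, le_div_iff₀ (by linarith), mul_comm]
    exact h2.le
  have hlogtop := tendsto_log_natCast_add_two
  have hr : Tendsto (fun n : ℕ => 1 - 1 / ((n : ℝ) + 2)) atTop (𝓝 1) := by
    have := ((tendsto_atTop_add_const_right atTop (2 : ℝ)
      tendsto_natCast_atTop_atTop).const_div_atTop 1).const_sub 1
    simpa using this
  -- At `r = 1 - 1/(n + 2)` one has `-log (1 - r) = log (n + 2)`. The second half of `ε` absorbs the
  -- constants once the logarithm is large.
  filter_upwards [hr.eventually (lt_mem_nhds ha1),
    hlogtop.eventually_gt_atTop ((‖B a‖ + ε / 2 * Real.log (1 - a) + 2 * C) / (ε / 2)),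
    hlogtop.eventually_gt_atTop 0] with n h1 h2 h3
  have hn : (0 : ℝ) < n + 2 := by positivity
  have h4 := hgrow _ h1.le (by have : 0 < 1 / ((n : ℝ) + 2) := by positivity
                               linarith)
  rw [sub_sub_cancel, one_div, Real.log_inv] at h4
  have h5 := norm_sum_sub_primitive_le hb n
  rw [div_lt_iff₀ (by positivity)] at h2
  rw [norm_div, Complex.norm_real, Real.norm_of_nonneg h3.le, div_lt_iff₀ h3]
  have h6 : ‖∑ k ∈ Finset.range (n + 1), b k / (k + 1)‖ ≤
      2 * C + ‖B ((1 - 1 / ((n : ℝ) + 2)))‖ := by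
    have := norm_add_le (∑ k ∈ Finset.range (n + 1), b k / (k + 1) - B (1 - 1 / ((n : ℝ) + 2)))
      (B (1 - 1 / ((n : ℝ) + 2)))
    rw [sub_add_cancel] at this
    exact this.trans (by gcongr)
  rw [one_div] at h6
  linarith

theorem tendsto_harmonic_div_log :
    Tendsto (fun n : ℕ => (harmonic (n + 1) : ℝ) / Real.log (n + 2)) atTop (𝓝 1) := by
  have h1 := (Real.tendsto_harmonic_sub_log_add_one).comp (tendsto_add_atTop_nat 1)
  have h2 := h1.div_atTop tendsto_log_natCast_add_two
  have h3 := h2.add_const 1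
  rw [zero_add] at h3
  refine h3.congr fun n => ?_
  have hl : Real.log ((n : ℝ) + 2) ≠ 0 :=
    (Real.log_pos (by have : (0 : ℝ) ≤ n := by positivity
                      linarith)).ne'
  simp only [Function.comp_apply]
  push_cast
  rw [add_assoc (n : ℝ), one_add_one_eq_two]
  field_simp
  ring

/-- The weights differ by `1 / ((2k + 1)(2k + 2))`, which is at most the telescoping `1/(k + 1) -
1/(k + 2)`. -/
theorem norm_sum_div_odd_sub_le {a : ℕ → ℂ} (ha : ∀ n, ‖a n‖ ≤ C) (n : ℕ) :
    ‖∑ k ∈ Finset.range n, (a k / (2 * k + 1) - a k / (2 * (k + 1)))‖ ≤ C := by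
  have hC : 0 ≤ C := (norm_nonneg _).trans (ha 0)
  have htel (n : ℕ) :
      ∑ k ∈ Finset.range n, C * (1 / ((k : ℝ) + 1) - 1 / ((k : ℝ) + 1 + 1)) ≤ C := by
    rw [← Finset.mul_sum]
    refine mul_le_of_le_one_right hC ?_
    have := Finset.sum_range_sub' (fun k : ℕ => 1 / ((k : ℝ) + 1)) n
    push_cast at this
    rw [this]
    have : 0 ≤ 1 / ((n : ℝ) + 1) := by positivity
    simpa using this
  refine (norm_sum_le_of_le _ fun k _ => ?_).trans (htel n)
  have e : a k / (2 * k + 1) - a k / (2 * (k + 1))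
      = ((1 / ((2 * k + 1) * (2 * (k + 1))) : ℝ) : ℂ) * a k := by
    have h1 : (2 * k + 1 : ℂ) ≠ 0 := by exact_mod_cast (2 * k).succ_ne_zero
    have h2 : (k + 1 : ℂ) ≠ 0 := by exact_mod_cast k.succ_ne_zero
    push_cast
    field_simp
    ring
  rw [e, norm_mul, Complex.norm_real, Real.norm_of_nonneg (by positivity), mul_comm]
  gcongr
  · exact ha k
  · rw [div_sub_div _ _ (by positivity) (by positivity)]
    have hk : (0 : ℝ) ≤ k := by positivity
    rw [div_le_div_iff₀ (by positivity) (by positivity)]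
    nlinarith

/-- Abel means of a bounded sequence determine its logarithmic means over the odd numbers. -/
theorem tendsto_logMean_of_abel {a : ℕ → ℂ} (ha : ∀ n, ‖a n‖ ≤ C) {m : ℂ}
    (h : Tendsto (fun r : ℝ => (1 - r) • ∑' n : ℕ, r ^ n • a n) (𝓝[<] 1) (𝓝 m)) :
    Tendsto (fun n : ℕ => (∑ k ∈ Finset.range (n + 1), a k / (2 * k + 1)) /
      (Real.log (n + 2) : ℂ)) atTop (𝓝 (m / 2)) := by
  have hb (n : ℕ) : ‖a n - m‖ ≤ C + ‖m‖ := (norm_sub_le _ _).trans (by gcongr; exact ha n)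
  have habel : Tendsto (fun r : ℝ => (1 - r) • ∑' n : ℕ, r ^ n • (a n - m)) (𝓝[<] 1) (𝓝 0) := by
    have h1 := h.sub_const m
    rw [sub_self] at h1
    refine h1.congr' ?_
    filter_upwards [Ioo_mem_nhdsLT (show (0 : ℝ) < 1 from zero_lt_one)] with r hr
    have hgeo := hasSum_geometric_of_lt_one hr.1.le hr.2
    have hs : Summable fun n : ℕ => r ^ n • a n := by
      refine Summable.of_norm_bounded (hgeo.summable.mul_right C) fun n => ?_
      rw [norm_smul, norm_pow, Real.norm_of_nonneg hr.1.le]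
      have := hr.1
      gcongr
      exact ha n
    have hm := hgeo.smul_const m
    simp only [smul_sub]
    rw [hs.tsum_sub hm.summable, hm.tsum_eq, smul_sub, smul_smul,
      mul_inv_cancel₀ (by linarith [hr.2]), one_smul]
  have h1 := tendsto_logMean_zero_of_abel hb habel
  have h2 : Tendsto (fun n : ℕ => (((harmonic (n + 1) : ℝ) / Real.log (n + 2) : ℝ) : ℂ)) atTop
      (𝓝 ((1 : ℝ) : ℂ)) := (Complex.continuous_ofReal.tendsto _).comp tendsto_harmonic_div_log
  have h3 : Tendsto (fun n : ℕ => (∑ k ∈ Finset.range (n + 1),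
      (a k / (2 * k + 1) - a k / (2 * (k + 1)))) / (Real.log (n + 2) : ℂ)) atTop (𝓝 0) := by
    refine squeeze_zero_norm' ?_ (tendsto_log_natCast_add_two.const_div_atTop C)
    filter_upwards [tendsto_log_natCast_add_two.eventually_gt_atTop 0] with n hn
    rw [norm_div, Complex.norm_real, Real.norm_of_nonneg hn.le]
    gcongr
    exact norm_sum_div_odd_sub_le ha _
  -- Here `a k / (2k + 1)` is split into half of `(a k - m) / (k + 1)`, the harmonic part `m / (2 (k
  -- + 1))`, and the bounded correction.
  have h4 := ((h1.div_const 2).add (h2.mul_const (m / 2))).add h3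
  simp only [zero_div, Complex.ofReal_one, one_mul, zero_add, add_zero] at h4
  refine h4.congr fun n => ?_
  have hh : (((harmonic (n + 1) : ℚ) : ℝ) : ℂ) = ∑ k ∈ Finset.range (n + 1), 1 / ((k : ℂ) + 1) := by
    rw [harmonic]
    push_cast
    simp
  rw [Complex.ofReal_div, hh, div_right_comm, div_mul_eq_mul_div, ← add_div, ← add_div,
    Finset.sum_div, Finset.sum_mul, ← Finset.sum_add_distrib, ← Finset.sum_add_distrib]
  congr 1
  refine Finset.sum_congr rfl fun k _ => ?_
  have h1 : (2 * k + 1 : ℂ) ≠ 0 := by exact_mod_cast (2 * k).succ_ne_zero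
  have h2 : (k + 1 : ℂ) ≠ 0 := by exact_mod_cast k.succ_ne_zero
  field_simp
  ring

/-- The Abel means of the diagonal entries of a multiplication operator in the Hermite basis. -/
theorem tendsto_abel_inner_hermiteBasis_mulOp (f : ℝ →ᵇ ℂ) {m : ℂ} (hm : HasAsymptoticMean f m) :
    Tendsto (fun r : ℝ => (1 - r) • ∑' n : ℕ, r ^ n •
      inner ℂ (hermiteBasis n) (mulOp f (hermiteBasis n))) (𝓝[<] 1) (𝓝 m) := by
  have hs : Tendsto (fun r : ℝ => (1 - r) / (1 + r)) (𝓝[<] 1) (𝓝[>] 0) := by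
    refine tendsto_nhdsWithin_iff.2 ⟨?_, ?_⟩
    · have hc : ContinuousAt (fun r : ℝ => (1 - r) / (1 + r)) 1 := by
        refine ContinuousAt.div (by fun_prop) (by fun_prop) (by norm_num)
      have := hc.tendsto.mono_left (nhdsWithin_le_nhds (s := Set.Iio 1))
      simpa using this
    · filter_upwards [Ioo_mem_nhdsLT (show (0 : ℝ) < 1 from zero_lt_one)] with r hr
      have h1 : 0 < 1 - r := by linarith [hr.2]
      have h2 : 0 < 1 + r := by linarith [hr.1]
      exact div_pos h1 h2
  -- With `s = (1 - r)/(1 + r)` the prefactor `(1 - r) / √(1 - r²)` equals `√s`, exactly the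
  -- normalization of the Gaussian mean.
  have h := ((tendsto_gaussian_mean f hm).comp hs).const_smul (√Real.pi)⁻¹
  have hpi : √Real.pi ≠ 0 := by positivity
  rw [smul_smul, inv_mul_cancel₀ hpi, one_smul] at h
  refine h.congr' ?_
  filter_upwards [Ioo_mem_nhdsLT (show (0 : ℝ) < 1 from zero_lt_one)] with r hr
  rw [(hasSum_inner_hermiteBasis_mulOp f hr.1.le hr.2).tsum_eq]
  simp only [Function.comp_apply]
  rw [smul_smul, smul_smul]
  congr 1
  have h1 : 0 < 1 - r := by linarith [hr.2]
  have h2 : 0 < 1 + r := by linarith [hr.1]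
  have e : 1 - r ^ 2 = (1 - r) * (1 + r) := by ring
  rw [e, Real.sqrt_mul h1.le, Real.sqrt_div h1.le]
  have h3 := Real.mul_self_sqrt h1.le
  have h4 : 0 < √(1 - r) := Real.sqrt_pos.2 h1
  have h5 : 0 < √(1 + r) := Real.sqrt_pos.2 h2
  field_simp
  linarith

end LogMean

end HarmonicDixmier

end

/-! ### The main theorem -/

theorem mainTheorem8 (ω : HarmonicDixmier.DixmierLimit) (f : BoundedContinuousFunction ℝ ℂ)
    (hf : UniformContinuous f) (m : ℂ) (hm : HarmonicDixmier.HasAsymptoticMean f m) :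
    HarmonicDixmier.IsBoundedInverse HarmonicDixmier.harmonicOscillator
        HarmonicDixmier.oscillatorInv ∧
      HarmonicDixmier.MemDixmierIdeal
        (HarmonicDixmier.mulOp f ∘L HarmonicDixmier.oscillatorInv) ∧
      HarmonicDixmier.dixmierTrace ω
        (HarmonicDixmier.mulOp f ∘L HarmonicDixmier.oscillatorInv) = m / 2 := by
  have hD := HarmonicDixmier.isOddReciprocalDiagonal_oscillatorInv
  refine ⟨HarmonicDixmier.isBoundedInverse_of_diagonal hD,
    HarmonicDixmier.memDixmierIdeal_comp_diagonal hD _,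
    HarmonicDixmier.dixmierTrace_comp_diagonal hD ω _ ?_⟩
  exact HarmonicDixmier.tendsto_logMean_of_abel
    (HarmonicDixmier.norm_inner_hermiteBasis_mulOp_le f)
    (HarmonicDixmier.tendsto_abel_inner_hermiteBasis_mulOp f hm)
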